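/- All graphs are finite and simple; $\Delta$ denotes the maximum degree of $G$. A graph is outerplanar if it has a drawing in the plane, without crossings, in which each vertex lies on the boundary of the outer (unbounded) face. The total graph $T(G)$ has the vertices and edges of $G$ as its vertices, two of them being adjacent if they are adjacent or incident in $G$. The coloring number $\mathrm{col}(H)$ is the smallest $k$ for which the vertices of $H$ can be ordered so that each vertex has at most $k-1$ neighbors among the earlier vertices. Let $A$ be a group, written additively (not necessarily commutative), and fix an orientation of a graph $H$; the notions below do not depend on it. $H$ is $A$-colorable if for every $f:E(H)\to A$ there is $c:V(H)\to A$ with $c(x)-c(y)\ne f(xy)$ for each edge directed from $x$ to $y$. The group chromatic number $\chi_g(H)$ is the smallest $k$ such that $H$ is $A$-colorable for every group $A$ of order at least $k$. The group choice number $\chi_{gl}(H)$ is the smallest $k$ such that for every group $A$ of order at least $k$, every assignment of lists $L(v)\subseteq A$ with $|L(v)|=k$ to the vertices of $H$, and every $f:E(H)\to A$, there is $c:V(H)\to A$ with $c(v)\in L(v)$ for every vertex $v$ and $c(x)-c(y)\neq f(xy)$ for each edge directed from $x$ to $y$. Put $\chi''_g(G)=\chi_g(T(G))$ and $\chi''_{gl}(G)=\chi_{gl}(T(G))$.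 **Theorem.** Let $G$ be an outerplanar graph with maximum degree $\Delta$. 1. If $k\ge 5$ is an integer and $\Delta\le k$, then $\mathrm{col}(T(G))\le k+1$. 2. If $\Delta\ne 4$, then $\chi''_{gl}(G)\le\max\{5,\Delta+1\}$. 3. If $\Delta\ge 5$, then $\chi''_{gl}(G)=\chi''_g(G)=\Delta+1$. -/

import Mathlib

universe u w

namespace SimpleGraph

/-- A drawing (plane embedding) of `G`: distinct points of the Euclidean plane for the vertices and,
for each edge, a simple arc joining the points of its two ends, such that the interior of an arc
contains no vertex and no point of another arc. -/
structure PlaneDrawing {V : Type u} (G : SimpleGraph V) where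
  point : V → EuclideanSpace ℝ (Fin 2)
  arc : G.edgeSet → unitInterval → EuclideanSpace ℝ (Fin 2)
  point_injective : Function.Injective point
  arc_continuous : ∀ e, Continuous (arc e)
  arc_injective : ∀ e, Function.Injective (arc e)
  arc_ends : ∀ e : G.edgeSet, s(arc e 0, arc e 1) = (e : Sym2 V).map point
  arc_eq_point : ∀ e t v, arc e t = point v → t = 0 ∨ t = 1
  arc_eq_arc : ∀ e e' t t', e ≠ e' → arc e t = arc e' t' → t = 0 ∨ t = 1

namespace PlaneDrawing

variable {V : Type u} {G : SimpleGraph V}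

/-- The set of points of the plane covered by the drawing. -/
def carrier (D : G.PlaneDrawing) : Set (EuclideanSpace ℝ (Fin 2)) :=
  Set.range D.point ∪ ⋃ e, Set.range (D.arc e)

/-- The outer face: the unbounded connected component of the complement of the drawing (of a finite
graph), given as the set of points whose component is unbounded. -/
def outerFace (D : G.PlaneDrawing) : Set (EuclideanSpace ℝ (Fin 2)) :=
  {x | x ∈ D.carrierᶜ ∧ ¬ Bornology.IsBounded (connectedComponentIn D.carrierᶜ x)}

end PlaneDrawing

/-- `G` is outerplanar: it has a drawing in the plane in which every vertex lies on the boundary of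
the outer face. -/
def IsOuterplanar {V : Type u} (G : SimpleGraph V) : Prop :=
  ∃ D : G.PlaneDrawing, ∀ v, D.point v ∈ frontier D.outerFace

/-- The total graph: its vertices are the vertices and the edges of `G`, and two of them are adjacent
if they are adjacent vertices, distinct edges with a common end, or an edge and one of its ends. -/
def totalGraph {V : Type u} (G : SimpleGraph V) : SimpleGraph (V ⊕ G.edgeSet) where
  Adj
    | .inl v, .inl w => G.Adj v w
    | .inl v, .inr e => v ∈ (e : Sym2 V)
    | .inr e, .inl v => v ∈ (e : Sym2 V)
    | .inr e, .inr e' => G.lineGraph.Adj e e'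
  symm := ⟨by
    rintro (v | e) (w | e') h
    · exact SimpleGraph.Adj.symm h
    · exact h
    · exact h
    · exact SimpleGraph.Adj.symm h⟩
  loopless := ⟨by
    rintro (v | e) h
    · exact G.irrefl h
    · exact G.lineGraph.irrefl h⟩

/-- The coloring number of a finite graph: the least `k` for which the vertices can be ordered such
that each vertex has at most `k - 1` neighbors that come earlier. -/
noncomputable def coloringNumber {V : Type u} (G : SimpleGraph V) : ℕ∞ :=
  ⨅ k ∈ {k : ℕ | ∃ σ : V ≃ Fin (Nat.card V), ∀ v, {x | G.Adj v x ∧ σ x < σ v}.ncard < k}, (k : ℕ∞)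

/-- An orientation of `G`: each edge is directed from its tail to its head. -/
structure EdgeOrientation {V : Type u} (G : SimpleGraph V) where
  tail : G.edgeSet → V
  head : G.edgeSet → V
  ends : ∀ e : G.edgeSet, s(tail e, head e) = (e : Sym2 V)

/-- `G` is `A`-colorable. The group `A`, in additive notation, need not be commutative. -/
def IsGroupColorable {V : Type u} (G : SimpleGraph V) (A : Type w) [AddGroup A] : Prop :=
  ∀ (o : G.EdgeOrientation) (f : G.edgeSet → A),
    ∃ c : V → A, ∀ e, c (o.tail e) - c (o.head e) ≠ f e

/-- `G` is `(A, L)`-colorable for the list assignment `L`. -/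
def IsGroupListColorable {V : Type u} (G : SimpleGraph V) (A : Type w) [AddGroup A]
    (L : V → Finset A) : Prop :=
  ∀ (o : G.EdgeOrientation) (f : G.edgeSet → A),
    ∃ c : V → A, (∀ v, c v ∈ L v) ∧ ∀ e, c (o.tail e) - c (o.head e) ≠ f e

/-- `G` is `k`-group choosable. -/
def IsGroupChoosable {V : Type u} (G : SimpleGraph V) (k : ℕ) : Prop :=
  ∀ (A : Type w) [AddGroup A], (k : ℕ∞) ≤ ENat.card A →
    ∀ L : V → Finset A, (∀ v, (L v).card = k) → G.IsGroupListColorable A L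

/-- The group chromatic number: the least `k` such that `G` is `A`-colorable for every group `A` (in
the universe `w`) of order at least `k`. -/
noncomputable def groupChromaticNumber {V : Type u} (G : SimpleGraph V) : ℕ∞ :=
  ⨅ k ∈ {k : ℕ | ∀ (A : Type w) [AddGroup A], (k : ℕ∞) ≤ ENat.card A → G.IsGroupColorable A},
    (k : ℕ∞)

/-- The group choice number: the least `k` such that `G` is `k`-group choosable. -/
noncomputable def groupChoiceNumber {V : Type u} (G : SimpleGraph V) : ℕ∞ :=
  ⨅ k ∈ {k : ℕ | IsGroupChoosable.{u, w} G k}, (k : ℕ∞)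

/-- The total group chromatic number. -/
noncomputable def totalGroupChromaticNumber {V : Type u} (G : SimpleGraph V) : ℕ∞ :=
  groupChromaticNumber.{u, w} G.totalGraph

/-- The total group choice number. -/
noncomputable def totalGroupChoiceNumber {V : Type u} (G : SimpleGraph V) : ℕ∞ :=
  groupChoiceNumber.{u, w} G.totalGraph

end SimpleGraph

/-!
The three claims follow from one order on the vertices of the total graph, and this order follows from
a local structure that every outerplanar graph has: some vertex `u` has at most two neighbors, and if
it has two, then one of them, `v`, has degree at most four (`SimpleGraph.exists_isLight`).
Given such a `u` with neighbors `v` and `x`, order the total graph of `G - u` and append the edge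
`s(u, x)`, the edge `s(u, v)` and the vertex `u`. If `4 ≤ k`, the maximum degree is at most `k` and the
degree of `v` is at most `k - 1`, then each of the three has at most `k` earlier neighbors
(`SimpleGraph.DegenerateOn.totalOn_of_diff`). Hence the coloring number of the total graph is at most
`k + 1` for `k ≥ 5`, and also for `k = 4` if the maximum degree is at most three. Coloring greedily
along the order bounds the group choice number, as each edge forbids one color at its later end. For
the lower bounds, a vertex of maximum degree and the edges at it form a clique, which the cyclic group
of order `Δ` cannot color.

The light vertex is found by excluding `K₄` and `K₂,₃` minors only. By induction on the size of a
connected set `C` of vertices, `C` contains a light vertex if at most one vertex outside of `C` has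
neighbors in it, and if there are two such vertices `p` and `q` that are connected outside of `C`,
then `C` contains a light vertex or is a single vertex (`SimpleGraph.LightAtCut`,
`SimpleGraph.LightAtTwoCut`). In the second case, delete a vertex `x` from `C`. A component that does
not touch both `p` and `q` is covered by induction, so it is a single vertex; if all components are of
this kind, there are at most two of them and `x` has degree at most four. Otherwise each `x` leaves a
component touching both `p` and `q`, and applying this to three successive neighbors of `p` yields a
`K₄` or `K₂,₃` minor.

That a graph with an outerplanar drawing has neither minor is shown without the Jordan curve theorem.
All vertices can be joined to a point `q` far away in the outer face by paths that avoid the part of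
the drawing not incident with them, so a `K₄` or `K₂,₃` minor would give a continuous map of `K₅` or
`K₃,₃` into the plane such that edges without a common end have disjoint images. Such maps do not
exist, by van Kampen's argument: for two disjoint paths `γ` and `δ`, the function `γ s - δ t` has a
continuous logarithm on the square, and so the changes of the logarithm along the four sides satisfy a
linear relation (`PlaneObstruction.logChange_square`). Compared with fixed logarithms of the
differences of the vertices, this is a relation between integers
(`PlaneObstruction.turns_square`). In the sum over all pairs of edges without a common end, each
integer occurs an even number of times, while the constant terms have an odd sum.
-/

/-! ### The change of the logarithm along a path -/

namespace PlaneObstruction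

open Complex

/-- A continuous nonvanishing function on the plane `ℝ × ℝ` has a continuous logarithm. -/
theorem exists_continuous_log (f : ℝ × ℝ → ℂ) (hf : Continuous f) (h0 : ∀ z, f z ≠ 0) :
    ∃ L : ℝ × ℝ → ℂ, Continuous L ∧ ∀ z, exp (L z) = f z := by
  obtain ⟨F, ⟨-, hF⟩, -⟩ := isCoveringMapOn_exp.existsUnique_continuousMap_lifts
    (⟨f, hf⟩ : C(ℝ × ℝ, ℂ)) (a₀ := (0, 0)) (e₀ := log (f (0, 0))) (exp_log (h0 _)) (fun a => h0 a)
  exact ⟨F, F.continuous, fun z => congrFun hF z⟩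

/-- Two continuous logarithms of the same function on the line change by the same amount. -/
theorem log_change_unique {l m : ℝ → ℂ} (hl : Continuous l) (hm : Continuous m)
    (h : ∀ t, exp (l t) = exp (m t)) (s t : ℝ) : l t - l s = m t - m s := by
  have key := isCoveringMapOn_exp.existsUnique_continuousMap_lifts
    (⟨fun t => exp (l t), by fun_prop⟩ : C(ℝ, ℂ)) (a₀ := s) (e₀ := l s) rfl
    (fun a => exp_ne_zero _)
  have h1 := key.unique (y₁ := ⟨l, hl⟩) (y₂ := ⟨fun t => m t + (l s - m s), by fun_prop⟩)
    ⟨rfl, rfl⟩ ⟨by simp, by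
      ext t
      simp [exp_add, exp_sub, h, exp_ne_zero]⟩
  have h2 := DFunLike.congr_fun h1 t
  simp only [ContinuousMap.coe_mk] at h2
  rw [h2]
  ring

open Classical in
/-- The total change of a continuous logarithm of `z - w` as `z` runs along the path `γ`
(zero if there is no such logarithm). -/
noncomputable def logChange (w : ℂ) {x y : ℂ} (γ : Path x y) : ℂ :=
  if h : ∃ l : ℝ → ℂ, Continuous l ∧ ∀ t, exp (l t) = γ.extend t - w then
    h.choose 1 - h.choose 0 else 0

theorem logChange_eq {w x y : ℂ} {γ : Path x y} {l : ℝ → ℂ} (hl : Continuous l)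
    (h : ∀ t, exp (l t) = γ.extend t - w) : logChange w γ = l 1 - l 0 := by
  have hex : ∃ l : ℝ → ℂ, Continuous l ∧ ∀ t, exp (l t) = γ.extend t - w := ⟨l, hl, h⟩
  rw [logChange, dif_pos hex]
  exact log_change_unique hex.choose_spec.1 hl
    (fun t => by rw [hex.choose_spec.2 t, h t]) 0 1

theorem exp_logChange {w x y : ℂ} {γ : Path x y} (hw : w ∉ Set.range γ) :
    exp (logChange w γ) = (y - w) / (x - w) := by
  have h0 : ∀ t : ℝ, γ.extend t - w ≠ 0 := fun t h => hw <| by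
    rw [← γ.extend_range]
    exact ⟨t, sub_eq_zero.1 h⟩
  obtain ⟨L, hL, hLe⟩ := exists_continuous_log (fun z => γ.extend z.1 - w)
    (by fun_prop) (fun z => h0 _)
  have := logChange_eq (w := w) (γ := γ) (l := fun t => L (t, 0)) (by fun_prop)
    (fun t => hLe (t, 0))
  rw [this, exp_sub, hLe, hLe]
  simp

/-- For two disjoint paths, a logarithm of the difference of a point of the first and a point of the
second exists on the whole square, so its changes along the two ways around the square agree. -/
theorem logChange_square {u v x y : ℂ} {γ : Path u v} {δ : Path x y}
    (h : Disjoint (Set.range γ) (Set.range δ)) :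
    logChange u δ + logChange y γ = logChange x γ + logChange v δ := by
  have h0 : ∀ s t : ℝ, γ.extend s - δ.extend t ≠ 0 := fun s t e => by
    rw [← γ.extend_range, ← δ.extend_range] at h
    exact Set.disjoint_left.1 h ⟨s, rfl⟩ ⟨t, (sub_eq_zero.1 e).symm⟩
  obtain ⟨L, hL, hLe⟩ := exists_continuous_log (fun z => γ.extend z.1 - δ.extend z.2)
    (by fun_prop) (fun z => h0 _ _)
  have hγ : ∀ t, logChange (δ.extend t) γ = L (1, t) - L (0, t) := fun t =>
    logChange_eq (l := fun s => L (s, t)) (by fun_prop) (fun s => hLe (s, t))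
  have hδ : ∀ s, logChange (γ.extend s) δ = L (s, 1) - L (s, 0) := fun s => by
    rw [logChange_eq (l := fun t => L (s, t) + Real.pi * I) (by fun_prop)
      (fun t => by rw [exp_add, hLe, exp_pi_mul_I]; ring)]
    ring
  have h1 := hγ 0
  have h2 := hγ 1
  have h3 := hδ 0
  have h4 := hδ 1
  rw [Path.extend_zero] at h1 h3
  rw [Path.extend_one] at h2 h4
  rw [h1, h2, h3, h4]
  ring

/-! ### The van Kampen obstruction of `K₅` and of `K₃,₃` -/

variable {ι : Type*} [LinearOrder ι]

/-- A logarithm of `a j - a i`, such that exchanging `i < j` adds `π * I`. -/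
noncomputable def logDiff (a : ι → ℂ) (i j : ι) : ℂ :=
  if i < j then log (a j - a i) else log (a i - a j) + Real.pi * I

theorem exp_logDiff {a : ι → ℂ} {i j : ι} (h : a i ≠ a j) : exp (logDiff a i j) = a j - a i := by
  unfold logDiff
  split_ifs
  · rw [exp_log (sub_ne_zero.2 h.symm)]
  · rw [exp_add, exp_log (sub_ne_zero.2 h), exp_pi_mul_I]
    ring

/-- `1` if `i < j` and `-1` otherwise. -/
def orderSign (i j : ι) : ℤ := if i < j then 1 else -1

theorem logDiff_sub {a : ι → ℂ} {i j : ι} (h : i ≠ j) :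
    logDiff a i j - logDiff a j i = -(orderSign i j * (Real.pi * I)) := by
  unfold logDiff orderSign
  rcases lt_or_gt_of_ne h with h | h
  · simp [h, h.not_gt]
  · simp [h, h.not_gt]

/-- The integer by which the change of the logarithm of `z - a w` along a path from `a u` to `a v`
differs from the one predicted by `logDiff`. -/
noncomputable def turns (a : ι → ℂ) (w : ι) {u v : ι} (γ : Path (a u) (a v)) : ℤ :=
  Classical.epsilon fun n : ℤ =>
    logChange (a w) γ = logDiff a w v - logDiff a w u + n * (2 * Real.pi * I)

theorem logChange_eq_turns {a : ι → ℂ} {w u v : ι} {γ : Path (a u) (a v)}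
    (hw : a w ∉ Set.range γ) :
    logChange (a w) γ = logDiff a w v - logDiff a w u + turns a w γ * (2 * Real.pi * I) := by
  refine Classical.epsilon_spec (p := fun n : ℤ =>
    logChange (a w) γ = logDiff a w v - logDiff a w u + n * (2 * Real.pi * I)) ?_
  rw [← exp_eq_exp_iff_exists_int, exp_logChange hw, exp_sub, exp_logDiff, exp_logDiff]
  · rintro h
    exact hw ⟨0, by rw [γ.source, h]⟩
  · rintro h
    exact hw ⟨1, by rw [γ.target, h]⟩

/-- The relation between the integers `turns` for two disjoint paths. Its right-hand side, divided by
two, is odd exactly if the pairs of ends interleave in the order of `ι`. -/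
theorem turns_square {a : ι → ℂ} {u v x y : ι} {γ : Path (a u) (a v)} {δ : Path (a x) (a y)}
    (h : Disjoint (Set.range γ) (Set.range δ)) :
    2 * (turns a u δ + turns a y γ - turns a x γ - turns a v δ) =
      orderSign u y + orderSign y v + orderSign v x + orderSign x u := by
  have hu : a u ∈ Set.range γ := ⟨0, γ.source⟩
  have hv : a v ∈ Set.range γ := ⟨1, γ.target⟩
  have hx : a x ∈ Set.range δ := ⟨0, δ.source⟩
  have hy : a y ∈ Set.range δ := ⟨1, δ.target⟩
  have ne : ∀ {i j}, a i ∈ Set.range γ → a j ∈ Set.range δ → i ≠ j := by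
    rintro i j hi hj rfl
    exact Set.disjoint_left.1 h hi hj
  have h1 := logChange_square h
  rw [logChange_eq_turns (Set.disjoint_left.1 h hu), logChange_eq_turns (Set.disjoint_left.1 h hv),
    logChange_eq_turns (Set.disjoint_right.1 h hx), logChange_eq_turns (Set.disjoint_right.1 h hy)]
    at h1
  have e1 := logDiff_sub (a := a) (ne hu hy)
  have e2 := logDiff_sub (a := a) (ne hv hy).symm
  have e3 := logDiff_sub (a := a) (ne hv hx)
  have e4 := logDiff_sub (a := a) (ne hu hx).symm
  have hpi : (Real.pi : ℂ) * I ≠ 0 := mul_ne_zero (by simp [Real.pi_ne_zero]) I_ne_zero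
  have : ((2 * (turns a u δ + turns a y γ - turns a x γ - turns a v δ) : ℤ) : ℂ) * (Real.pi * I) =
      ((orderSign u y + orderSign y v + orderSign v x + orderSign x u : ℤ) : ℂ)
        * (Real.pi * I) := by
    push_cast
    linear_combination h1 - e1 - e2 - e3 - e4
  exact_mod_cast mul_right_cancel₀ hpi this

/-- There is no continuous map of `K₅` into the plane for which edges without a common end have
disjoint images. -/
theorem no_planar_K5 (a : Fin 5 → ℂ) (γ : ∀ i j, i < j → Path (a i) (a j))
    (h : ∀ i j (hij : i < j) k l (hkl : k < l), i ≠ k → i ≠ l → j ≠ k → j ≠ l →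
      Disjoint (Set.range (γ i j hij)) (Set.range (γ k l hkl))) : False := by
  have key := fun i j hij k l hkl h1 h2 h3 h4 => turns_square (h i j hij k l hkl h1 h2 h3 h4)
  -- the sum over all pairs of disjoint edges is a parity contradiction
  have e1 := key 0 1 (by decide) 2 3 (by decide) (by decide) (by decide) (by decide) (by decide)
  have e2 := key 0 1 (by decide) 2 4 (by decide) (by decide) (by decide) (by decide) (by decide)
  have e3 := key 0 1 (by decide) 3 4 (by decide) (by decide) (by decide) (by decide) (by decide)
  have e4 := key 0 2 (by decide) 1 3 (by decide) (by decide) (by decide) (by decide) (by decide)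
  have e5 := key 0 2 (by decide) 1 4 (by decide) (by decide) (by decide) (by decide) (by decide)
  have e6 := key 0 2 (by decide) 3 4 (by decide) (by decide) (by decide) (by decide) (by decide)
  have e7 := key 0 3 (by decide) 1 2 (by decide) (by decide) (by decide) (by decide) (by decide)
  have e8 := key 0 3 (by decide) 1 4 (by decide) (by decide) (by decide) (by decide) (by decide)
  have e9 := key 0 3 (by decide) 2 4 (by decide) (by decide) (by decide) (by decide) (by decide)
  have e10 := key 0 4 (by decide) 1 2 (by decide) (by decide) (by decide) (by decide) (by decide)
  have e11 := key 0 4 (by decide) 1 3 (by decide) (by decide) (by decide) (by decide) (by decide)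
  have e12 := key 0 4 (by decide) 2 3 (by decide) (by decide) (by decide) (by decide) (by decide)
  have e13 := key 1 2 (by decide) 3 4 (by decide) (by decide) (by decide) (by decide) (by decide)
  have e14 := key 1 3 (by decide) 2 4 (by decide) (by decide) (by decide) (by decide) (by decide)
  have e15 := key 1 4 (by decide) 2 3 (by decide) (by decide) (by decide) (by decide) (by decide)
  simp only [orderSign, Fin.lt_def] at e1 e2 e3 e4 e5 e6 e7 e8 e9 e10 e11 e12 e13 e14 e15
  norm_num at e1 e2 e3 e4 e5 e6 e7 e8 e9 e10 e11 e12 e13 e14 e15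
  omega

/-- There is no continuous map of `K₃,₃` into the plane for which edges without a common end have
disjoint images. -/
theorem no_planar_K33 (p q : Fin 3 → ℂ) (γ : ∀ i j, Path (p i) (q j))
    (h : ∀ i j k l, i ≠ k → j ≠ l → Disjoint (Set.range (γ i j)) (Set.range (γ k l))) : False := by
  let a : Fin 3 ⊕ₗ Fin 3 → ℂ := fun s => Sum.elim p q (ofLex s)
  let δ : ∀ i j, Path (a (Sum.inlₗ i)) (a (Sum.inrₗ j)) := γ
  have key : ∀ i j k l, i ≠ k → j ≠ l →
    2 * (turns a (Sum.inlₗ i) (δ k l) + turns a (Sum.inrₗ l) (δ i j)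
      - turns a (Sum.inlₗ k) (δ i j) - turns a (Sum.inrₗ j) (δ k l)) =
      1 + orderSign l j - 1 + orderSign k i := by
    intro i j k l h1 h2
    refine (turns_square (h i j k l h1 h2 : Disjoint (Set.range (δ i j)) (Set.range (δ k l)))).trans
      ?_
    simp [orderSign, Sum.inlₗ, Sum.inrₗ]
  -- the sum over all pairs of disjoint edges is a parity contradiction
  have e1 := key 0 0 1 1 (by decide) (by decide)
  have e2 := key 0 0 1 2 (by decide) (by decide)
  have e3 := key 0 0 2 1 (by decide) (by decide)
  have e4 := key 0 0 2 2 (by decide) (by decide)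
  have e5 := key 0 1 1 0 (by decide) (by decide)
  have e6 := key 0 1 1 2 (by decide) (by decide)
  have e7 := key 0 1 2 0 (by decide) (by decide)
  have e8 := key 0 1 2 2 (by decide) (by decide)
  have e9 := key 0 2 1 0 (by decide) (by decide)
  have e10 := key 0 2 1 1 (by decide) (by decide)
  have e11 := key 0 2 2 0 (by decide) (by decide)
  have e12 := key 0 2 2 1 (by decide) (by decide)
  have e13 := key 1 0 2 1 (by decide) (by decide)
  have e14 := key 1 0 2 2 (by decide) (by decide)
  have e15 := key 1 1 2 0 (by decide) (by decide)
  have e16 := key 1 1 2 2 (by decide) (by decide)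
  have e17 := key 1 2 2 0 (by decide) (by decide)
  have e18 := key 1 2 2 1 (by decide) (by decide)
  simp only [orderSign, Fin.lt_def] at *
  norm_num at e1 e2 e3 e4 e5 e6 e7 e8 e9 e10 e11 e12 e13 e14 e15 e16 e17 e18
  omega

end PlaneObstruction

/-! ### Connected sets of vertices -/

namespace SimpleGraph

variable {V : Type u} {G : SimpleGraph V}

/-- `S` is a nonempty set of vertices that induces a connected subgraph, expressed by cuts: no
proper nonempty subset of `S` is closed under adjacency inside `S`. -/
def ConnSet (G : SimpleGraph V) (S : Set V) : Prop :=
  S.Nonempty ∧ ∀ A ⊆ S, A.Nonempty → (∀ a ∈ A, ∀ b ∈ S, G.Adj a b → b ∈ A) → S ⊆ A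

/-- There is an edge with one end in `A` and the other in `B`. -/
def Touches (G : SimpleGraph V) (A B : Set V) : Prop := ∃ a ∈ A, ∃ b ∈ B, G.Adj a b

theorem Touches.symm {A B : Set V} (h : G.Touches A B) : G.Touches B A := by
  obtain ⟨a, ha, b, hb, hab⟩ := h
  exact ⟨b, hb, a, ha, hab.symm⟩

theorem Touches.mono {A B A' B' : Set V} (h : G.Touches A B) (hA : A ⊆ A') (hB : B ⊆ B') :
    G.Touches A' B' := by
  obtain ⟨a, ha, b, hb, hab⟩ := h
  exact ⟨a, hA ha, b, hB hb, hab⟩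

theorem touches_singleton {A : Set V} {b : V} : G.Touches A {b} ↔ ∃ a ∈ A, G.Adj a b := by
  simp [Touches]

theorem touches_singleton_singleton {a b : V} : G.Touches {a} {b} ↔ G.Adj a b := by
  simp [Touches]

theorem connSet_singleton (a : V) : G.ConnSet {a} := by
  refine ⟨Set.singleton_nonempty a, fun A hA hne _ => ?_⟩
  rw [Set.Nonempty.subset_singleton_iff hne] at hA
  exact hA.ge

theorem ConnSet.union_of_mem {A B : Set V} (hA : G.ConnSet A) (hB : G.ConnSet B) {x : V}
    (hxA : x ∈ A) (hxB : x ∈ B) : G.ConnSet (A ∪ B) := by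
  refine ⟨hA.1.mono Set.subset_union_left, fun D hD hne hcl => ?_⟩
  have step : ∀ {A : Set V}, G.ConnSet A → (∀ a ∈ D, ∀ b ∈ A, G.Adj a b → b ∈ D) →
      (A ∩ D).Nonempty → A ⊆ D := fun hA hcl hne =>
    (hA.2 _ Set.inter_subset_left hne
      (fun a ha b hb hab => ⟨hb, hcl a ha.2 b hb hab⟩)).trans Set.inter_subset_right
  have sA := step hA (fun a ha b hb => hcl a ha b (Or.inl hb))
  have sB := step hB (fun a ha b hb => hcl a ha b (Or.inr hb))
  obtain ⟨d, hd⟩ := hne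
  rcases hD hd with h | h
  · have hAD := sA ⟨d, h, hd⟩
    exact Set.union_subset hAD (sB ⟨x, hxB, hAD hxA⟩)
  · have hBD := sB ⟨d, h, hd⟩
    exact Set.union_subset (sA ⟨x, hxA, hBD hxB⟩) hBD

theorem connSet_pair {a b : V} (h : G.Adj a b) : G.ConnSet {a, b} := by
  refine ⟨⟨a, by simp⟩, fun D hD ⟨d, hd⟩ hcl => ?_⟩
  have hd' := hD hd
  simp only [Set.mem_insert_iff, Set.mem_singleton_iff] at hd'
  rintro x (rfl | rfl) <;> rcases hd' with rfl | rfl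
  · exact hd
  · exact hcl _ hd _ (by simp) h.symm
  · exact hcl _ hd _ (by simp) h
  · exact hd

theorem ConnSet.union {A B : Set V} (hA : G.ConnSet A) (hB : G.ConnSet B) (h : G.Touches A B) :
    G.ConnSet (A ∪ B) := by
  obtain ⟨a, ha, b, hb, hab⟩ := h
  have h1 := hA.union_of_mem (connSet_pair hab) ha (by simp)
  have h2 := h1.union_of_mem hB (x := b) (by simp) hb
  convert h2 using 1
  ext z
  simp only [Set.mem_union, Set.mem_insert_iff, Set.mem_singleton_iff]
  constructor
  · rintro (h | h) <;> simp [h]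
  · rintro ((h | rfl | rfl) | h) <;> simp [*]

theorem ConnSet.mono {H : SimpleGraph V} {A : Set V} (h : H.ConnSet A) (hle : H ≤ G) :
    G.ConnSet A :=
  ⟨h.1, fun D hD hne hcl => h.2 D hD hne fun a ha b hb hab => hcl a ha b hb (hle hab)⟩

/-- An edge leads from a proper nonempty subset of a connected set to the rest of that set. -/
theorem ConnSet.exists_adj {S A : Set V} (hS : G.ConnSet S) (hA : A ⊆ S) (hne : A.Nonempty)
    {y : V} (hy : y ∈ S) (hyA : y ∉ A) : ∃ a ∈ A, ∃ b ∈ S, b ∉ A ∧ G.Adj a b := by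
  by_contra! h
  exact hyA (hS.2 A hA hne (fun a ha b hb hab => by_contra fun hbA => h a ha b hb hbA hab) hy)

/-! ### Minors of outerplanar graphs -/

namespace PlaneDrawing

variable (D : G.PlaneDrawing)

/-- The part of a drawing that represents the subgraph induced by `S`. -/
def region (S : Set V) : Set (EuclideanSpace ℝ (Fin 2)) :=
  D.point '' S ∪ ⋃ e ∈ {e : G.edgeSet | ∀ v ∈ (e : Sym2 V), v ∈ S}, Set.range (D.arc e)

theorem point_mem_region {S : Set V} {v : V} (hv : v ∈ S) : D.point v ∈ D.region S :=
  Or.inl ⟨v, hv, rfl⟩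

theorem region_mono {S T : Set V} (h : S ⊆ T) : D.region S ⊆ D.region T := by
  refine Set.union_subset_union (Set.image_mono h) ?_
  exact Set.biUnion_subset_biUnion_left fun e he v hv => h (he v hv)

theorem region_univ : D.region Set.univ = D.carrier := by
  simp [region, carrier]

/-- The ends of an arc are the points of the ends of its edge. -/
theorem arc_end {e : G.edgeSet} {t : unitInterval} (ht : t = 0 ∨ t = 1) :
    ∃ v ∈ (e : Sym2 V), D.arc e t = D.point v := by
  have h : D.arc e t ∈ (e : Sym2 V).map D.point := by
    rw [← D.arc_ends e]
    rcases ht with rfl | rfl <;> simp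
  obtain ⟨v, hv, h⟩ := Sym2.mem_map.1 h
  exact ⟨v, hv, h.symm⟩

theorem disjoint_region {S T : Set V} (h : Disjoint S T) :
    Disjoint (D.region S) (D.region T) := by
  rw [Set.disjoint_left] at h ⊢
  have mixed : ∀ {S T : Set V} (_ : ∀ ⦃a⦄, a ∈ S → a ∉ T) {v : V} {e : G.edgeSet}
      {t : unitInterval}, v ∈ S → (∀ v ∈ (e : Sym2 V), v ∈ T) → D.arc e t ≠ D.point v := by
    intro S T h v e t hv he heq
    obtain ⟨w, hw, h'⟩ := D.arc_end (e := e) (D.arc_eq_point e t v heq)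
    exact h hv (D.point_injective (heq.symm.trans h') ▸ he w hw)
  rintro z (⟨v, hv, rfl⟩ | hz) (⟨w, hw, hz'⟩ | hz')
  · exact h hv (D.point_injective hz' ▸ hw)
  · simp only [Set.mem_iUnion, Set.mem_range] at hz'
    obtain ⟨e, he, t, ht⟩ := hz'
    exact mixed h hv he ht
  · simp only [Set.mem_iUnion, Set.mem_range] at hz
    obtain ⟨e, he, t, ht⟩ := hz
    exact mixed (fun a ha hb => h hb ha) hw he (ht.trans hz'.symm)
  · simp only [Set.mem_iUnion, Set.mem_range] at hz hz'
    obtain ⟨e, he, t, ht⟩ := hz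
    obtain ⟨e', he', t', ht'⟩ := hz'
    have hne : e ≠ e' := by
      rintro rfl
      obtain ⟨v, hv, -⟩ := D.arc_end (e := e) (Or.inl rfl)
      exact h (he v hv) (he' v hv)
    obtain ⟨v, hv, h1⟩ := D.arc_end (e := e) (D.arc_eq_arc e e' t t' hne (ht.trans ht'.symm))
    exact mixed h (he v hv) he' (ht'.trans (ht.symm.trans h1))

theorem joinedIn_of_adj {S : Set V} {a b : V} (ha : a ∈ S) (hb : b ∈ S) (hab : G.Adj a b) :
    JoinedIn (D.region S) (D.point a) (D.point b) := by
  let e : G.edgeSet := ⟨s(a, b), hab⟩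
  have hsub : ∀ t, D.arc e t ∈ D.region S := fun t => by
    refine Or.inr (Set.mem_biUnion (x := e) ?_ ⟨t, rfl⟩)
    intro v hv
    rcases Sym2.mem_iff.1 hv with rfl | rfl <;> assumption
  have hj : JoinedIn (D.region S) (D.arc e 0) (D.arc e 1) :=
    ⟨⟨⟨D.arc e, D.arc_continuous e⟩, rfl, rfl⟩, hsub⟩
  have he := D.arc_ends e
  rw [Sym2.map_mk, Sym2.eq_iff] at he
  rcases he with ⟨h0, h1⟩ | ⟨h0, h1⟩
  · rwa [h0, h1] at hj
  · rw [h0, h1] at hj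
    exact hj.symm

theorem joinedIn_region {S : Set V} (hS : G.ConnSet S) {a b : V} (ha : a ∈ S) (hb : b ∈ S) :
    JoinedIn (D.region S) (D.point a) (D.point b) :=
  (hS.2 {v ∈ S | JoinedIn (D.region S) (D.point a) (D.point v)} (Set.sep_subset _ _)
    ⟨a, ha, JoinedIn.refl (D.point_mem_region ha)⟩
    (fun _ hx _ hy hxy => ⟨hy, hx.2.trans (D.joinedIn_of_adj hx.1 hy hxy)⟩) hb).2

theorem isCompact_region [Finite V] (S : Set V) : IsCompact (D.region S) :=
  (S.toFinite.image _).isCompact.union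
    (Set.Finite.isCompact_biUnion (Set.toFinite _)
      fun e _ => isCompact_range (D.arc_continuous e))

theorem isPathConnected_compl_closedBall {r : ℝ} (hr : 0 ≤ r) :
    IsPathConnected (Metric.closedBall (0 : EuclideanSpace ℝ (Fin 2)) r)ᶜ := by
  have hrank : 1 < Module.rank ℝ (EuclideanSpace ℝ (Fin 2)) := by
    rw [← Module.finrank_eq_rank, finrank_euclideanSpace_fin]
    norm_num
  have hs := isPathConnected_sphere hrank (0 : EuclideanSpace ℝ (Fin 2)) zero_le_one
  have hI : IsPathConnected (Set.Ioi r) := (convex_Ioi _).isPathConnected ⟨r + 1, by simp⟩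
  have him := (hI.prod hs).image (f := fun z : ℝ × EuclideanSpace ℝ (Fin 2) => z.1 • z.2)
    (by fun_prop)
  convert him using 1
  ext x
  simp only [Set.mem_compl_iff, Metric.mem_closedBall, dist_zero_right, not_le, Set.mem_image,
    Set.mem_prod, Set.mem_Ioi, mem_sphere_iff_norm, sub_zero, Prod.exists]
  constructor
  · intro h
    have hx : ‖x‖ ≠ 0 := (hr.trans_lt h).ne'
    exact ⟨‖x‖, ‖x‖⁻¹ • x, ⟨h, by rw [norm_smul, norm_inv, norm_norm, inv_mul_cancel₀ hx]⟩,
      by rw [smul_smul, mul_inv_cancel₀ hx, one_smul]⟩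
  · rintro ⟨c, y, ⟨h1, h2⟩, rfl⟩
    rw [norm_smul, h2, mul_one, Real.norm_eq_abs]
    exact h1.trans_le (le_abs_self c)

/-- The outer face of a finite drawing is path connected: all its points can be joined, off the
drawing, to one point that is far away. -/
theorem exists_joinedIn_outerFace [Finite V] :
    ∃ q, ∀ x ∈ D.outerFace, JoinedIn D.carrierᶜ x q := by
  have hc : IsCompact D.carrier := D.region_univ ▸ D.isCompact_region Set.univ
  obtain ⟨r, hr, hsub⟩ := hc.isBounded.subset_closedBall_lt 0 0
  have hpc := isPathConnected_compl_closedBall hr.le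
  obtain ⟨q, hq⟩ := hpc.nonempty
  refine ⟨q, fun x hx => ?_⟩
  obtain ⟨y, hy, hyr⟩ := Set.not_subset.1 fun h =>
    hx.2 (Metric.isBounded_closedBall (x := 0) (r := r) |>.subset h)
  have hconn : IsPathConnected (connectedComponentIn D.carrierᶜ x) :=
    (hc.isClosed.isOpen_compl.connectedComponentIn.isConnected_iff_isPathConnected).1
      (isConnected_connectedComponentIn_iff.2 hx.1)
  exact ((hconn.joinedIn x (mem_connectedComponentIn hx.1) y hy).mono
    (connectedComponentIn_subset _ _)).trans
    ((hpc.joinedIn y hyr q hq).mono (Set.compl_subset_compl.2 hsub))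

/-- A point far away can be joined to a vertex `v` on the boundary of the outer face without meeting
the part of the drawing that is not incident with `v`. -/
theorem joinedIn_compl_region [Finite V] {q : EuclideanSpace ℝ (Fin 2)}
    (hq : ∀ x ∈ D.outerFace, JoinedIn D.carrierᶜ x q) {v : V}
    (hv : D.point v ∈ frontier D.outerFace) :
    JoinedIn (D.region {v}ᶜ)ᶜ (D.point v) q := by
  have hmem : D.point v ∈ (D.region {v}ᶜ)ᶜ := fun h =>
    Set.disjoint_left.1 (D.disjoint_region (S := {v}) (T := {v}ᶜ) disjoint_compl_right)
      (D.point_mem_region rfl) h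
  have hopen := (D.isCompact_region {v}ᶜ).isClosed.isOpen_compl
  obtain ⟨ε, hε, hball⟩ := Metric.isOpen_iff.1 hopen _ hmem
  obtain ⟨x, hx, hxd⟩ := Metric.mem_closure_iff.1 (frontier_subset_closure hv) ε hε
  have h1 : JoinedIn (Metric.ball (D.point v) ε) (D.point v) x :=
    (Metric.isPathConnected_ball hε).joinedIn _ (Metric.mem_ball_self hε) _
      (by rwa [Metric.mem_ball, _root_.dist_comm])
  refine (h1.mono hball).trans ((hq x hx).mono (Set.compl_subset_compl.2 ?_))
  rw [← D.region_univ]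
  exact D.region_mono (Set.subset_univ _)

end PlaneDrawing

/-- A homeomorphism from the Euclidean plane to `ℂ`. -/
noncomputable def planeToComplex : EuclideanSpace ℝ (Fin 2) ≃ₜ ℂ :=
  Complex.orthonormalBasisOneI.repr.symm.toHomeomorph

/-- The path in `ℂ` that corresponds to a path inside a set `F` of the Euclidean plane. -/
noncomputable def complexPath {F : Set (EuclideanSpace ℝ (Fin 2))}
    {x y : EuclideanSpace ℝ (Fin 2)} (h : JoinedIn F x y) :
    _root_.Path (planeToComplex x) (planeToComplex y) :=
  h.somePath.map planeToComplex.continuous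

theorem disjoint_complexPath {F F' : Set (EuclideanSpace ℝ (Fin 2))}
    {x y x' y' : EuclideanSpace ℝ (Fin 2)} (h : JoinedIn F x y) (h' : JoinedIn F' x' y')
    (hF : Disjoint F F') :
    Disjoint (Set.range (complexPath h)) (Set.range (complexPath h')) := by
  rw [Set.disjoint_left] at hF ⊢
  rintro _ ⟨t, rfl⟩ ⟨t', ht'⟩
  have : h'.somePath t' = h.somePath t := planeToComplex.injective ht'
  exact hF (h.somePath_mem t) (this ▸ h'.somePath_mem t')

/-- `G` has no `K₄` minor: there are no four disjoint connected sets of vertices that pairwise touch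
each other. -/
def K4MinorFree (G : SimpleGraph V) : Prop :=
  ∀ B : Fin 4 → Set V, (∀ i, G.ConnSet (B i)) → (∀ i j, i < j → Disjoint (B i) (B j)) →
    (∀ i j, i < j → G.Touches (B i) (B j)) → False

/-- `G` has no `K₂,₃` minor: there are no five disjoint connected sets of vertices such that each of
the first two touches each of the last three. -/
def K23MinorFree (G : SimpleGraph V) : Prop :=
  ∀ (A : Fin 2 → Set V) (B : Fin 3 → Set V), (∀ i, G.ConnSet (A i)) → (∀ j, G.ConnSet (B j)) →
    (∀ i j, i ≠ j → Disjoint (A i) (A j)) → (∀ i j, i ≠ j → Disjoint (B i) (B j)) →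
    (∀ i j, Disjoint (A i) (B j)) → (∀ i j, G.Touches (A i) (B j)) → False

/-- Joining a point of the outer face to the vertices would turn a `K₄` minor into a `K₅`. -/
theorem IsOuterplanar.k4MinorFree [Finite V] (hG : G.IsOuterplanar) : G.K4MinorFree := by
  intro B hB hdisj htouch
  obtain ⟨D, hD⟩ := hG
  obtain ⟨q, hq⟩ := D.exists_joinedIn_outerFace
  choose r hr using fun i => (hB i).1
  have hr' : ∀ i j, i ≠ j → r i ∉ B j := fun i j hij h => by
    rcases lt_or_gt_of_ne hij with h' | h'
    · exact Set.disjoint_left.1 (hdisj i j h') (hr i) h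
    · exact Set.disjoint_right.1 (hdisj j i h') (hr i) h
  have hdisj' : ∀ i j, i ≠ j → Disjoint (B i) (B j) := fun i j hij => by
    rcases lt_or_gt_of_ne hij with h' | h'
    · exact hdisj i j h'
    · exact (hdisj j i h').symm
  let a : Fin 5 → EuclideanSpace ℝ (Fin 2) := Fin.snoc (fun i => D.point (r i)) q
  let F : Fin 5 → Fin 5 → Set (EuclideanSpace ℝ (Fin 2)) := fun i j =>
    Fin.lastCases (motive := fun _ => Set (EuclideanSpace ℝ (Fin 2))) ∅ (fun i' =>
      Fin.lastCases (motive := fun _ => Set (EuclideanSpace ℝ (Fin 2))) (D.region {r i'}ᶜ)ᶜ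
        (fun j' => D.region (B i' ∪ B j')) j) i
  have hF : ∀ i j : Fin 4, F i.castSucc j.castSucc = D.region (B i ∪ B j) := fun i j => by
    simp only [F, Fin.lastCases_castSucc]
  have hF' : ∀ i : Fin 4, F i.castSucc (Fin.last 4) = (D.region {r i}ᶜ)ᶜ := fun i => by
    simp only [F, Fin.lastCases_castSucc, Fin.lastCases_last]
  have hj : ∀ i j, i < j → JoinedIn (F i j) (a i) (a j) := by
    intro i j hij
    induction i using Fin.lastCases with
    | last => exact absurd (Fin.le_last j) hij.not_ge
    | cast i =>
      induction j using Fin.lastCases with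
      | last =>
        rw [hF']
        simpa only [a, Fin.snoc_castSucc, Fin.snoc_last] using D.joinedIn_compl_region hq (hD (r i))
      | cast j =>
        rw [hF]
        simpa only [a, Fin.snoc_castSucc] using D.joinedIn_region
          ((hB i).union (hB j) (htouch i j (Fin.castSucc_lt_castSucc_iff.1 hij)))
          (Or.inl (hr i)) (Or.inr (hr j))
  refine PlaneObstruction.no_planar_K5 (fun i => planeToComplex (a i))
    (fun i j hij => complexPath (hj i j hij)) fun i j hij k l hkl hik hil hjk hjl =>
      disjoint_complexPath (hj i j hij) (hj k l hkl) ?_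
  induction i using Fin.lastCases with
  | last => exact absurd (Fin.le_last j) hij.not_ge
  | cast i =>
  induction k using Fin.lastCases with
  | last => exact absurd (Fin.le_last l) hkl.not_ge
  | cast k =>
  induction j using Fin.lastCases with
  | last =>
    induction l using Fin.lastCases with
    | last => exact absurd rfl hjl
    | cast l =>
      rw [hF, hF']
      refine Set.disjoint_compl_left_iff_subset.2 (D.region_mono ?_)
      rintro v (hv | hv) rfl
      · exact hr' i k (by simpa using hik) hv
      · exact hr' i l (by simpa using hil) hv
  | cast j =>
    induction l using Fin.lastCases with
    | last =>
      rw [hF, hF']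
      refine Set.disjoint_compl_right_iff_subset.2 (D.region_mono ?_)
      rintro v (hv | hv) rfl
      · exact hr' k i (by simpa using hik.symm) hv
      · exact hr' k j (by simpa using hjk.symm) hv
    | cast l =>
      rw [hF, hF]
      refine D.disjoint_region ?_
      simp only [ne_eq, Fin.castSucc_inj] at hik hil hjk hjl
      simp only [Set.disjoint_union_left, Set.disjoint_union_right]
      exact ⟨⟨hdisj' _ _ hik, hdisj' _ _ hjk⟩, hdisj' _ _ hil, hdisj' _ _ hjl⟩

/-- Joining a point of the outer face to the vertices would turn a `K₂,₃` minor into a `K₃,₃`. -/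
theorem IsOuterplanar.k23MinorFree [Finite V] (hG : G.IsOuterplanar) : G.K23MinorFree := by
  intro A B hA hB hAA hBB hAB htouch
  obtain ⟨D, hD⟩ := hG
  obtain ⟨q, hq⟩ := D.exists_joinedIn_outerFace
  choose r hr using fun i => (hA i).1
  choose s hs using fun i => (hB i).1
  let a : Fin 3 → EuclideanSpace ℝ (Fin 2) := Fin.snoc (fun i => D.point (r i)) q
  let F : Fin 3 → Fin 3 → Set (EuclideanSpace ℝ (Fin 2)) := fun i j =>
    Fin.lastCases (motive := fun _ => Set (EuclideanSpace ℝ (Fin 2))) (D.region {s j}ᶜ)ᶜ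
      (fun i' => D.region (A i' ∪ B j)) i
  have hF : ∀ (i : Fin 2) j, F i.castSucc j = D.region (A i ∪ B j) := fun i j => by
    simp [F]
  have hF' : ∀ j, F (Fin.last 2) j = (D.region {s j}ᶜ)ᶜ := fun i => by
    simp only [F, Fin.lastCases_last]
  have hj : ∀ i j, JoinedIn (F i j) (a i) (D.point (s j)) := by
    intro i j
    induction i using Fin.lastCases with
    | last =>
      rw [hF']
      simpa only [a, Fin.snoc_last] using (D.joinedIn_compl_region hq (hD (s j))).symm
    | cast i =>
      rw [hF]
      simpa only [a, Fin.snoc_castSucc] using D.joinedIn_region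
        ((hA i).union (hB j) (htouch i j)) (Or.inl (hr i)) (Or.inr (hs j))
  refine PlaneObstruction.no_planar_K33 (fun i => planeToComplex (a i))
    (fun j => planeToComplex (D.point (s j)))
    (fun i j => complexPath (hj i j)) fun i j k l hik hjl =>
      disjoint_complexPath (hj i j) (hj k l) ?_
  have aux : ∀ (i : Fin 2) (j l : Fin 3), j ≠ l → D.region (A i ∪ B j) ⊆ D.region {s l}ᶜ := by
    intro i j l hjl
    refine D.region_mono ?_
    rintro v (hv | hv) rfl
    · exact Set.disjoint_left.1 (hAB i l) hv (hs l)
    · exact Set.disjoint_left.1 (hBB j l hjl) hv (hs l)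
  induction i using Fin.lastCases with
  | last =>
    induction k using Fin.lastCases with
    | last => exact absurd rfl hik
    | cast k =>
      rw [hF, hF']
      exact Set.disjoint_compl_left_iff_subset.2 (aux k l j hjl.symm)
  | cast i =>
    induction k using Fin.lastCases with
    | last =>
      rw [hF, hF']
      exact Set.disjoint_compl_right_iff_subset.2 (aux i j l hjl)
    | cast k =>
      rw [hF, hF]
      refine D.disjoint_region ?_
      have hik' : i ≠ k := fun h => hik (by rw [h])
      simp only [Set.disjoint_union_left, Set.disjoint_union_right]
      exact ⟨⟨hAA _ _ hik', (hAB _ _).symm⟩, hAB _ _, hBB _ _ hjl⟩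

end SimpleGraph

/-! ### Components and their boundaries -/

namespace SimpleGraph

variable {V : Type u} {G : SimpleGraph V}

/-- The vertices that can be reached from `x` through vertices of `S`; for `x ∈ S`, this is the vertex
set of a component of the subgraph induced by `S`. -/
def componentIn (G : SimpleGraph V) (S : Set V) (x : V) : Set V :=
  {y | Relation.ReflTransGen (fun a b => G.Adj a b ∧ b ∈ S) x y}

section componentIn

variable {S : Set V} {x y a b : V}

theorem mem_componentIn_self : x ∈ G.componentIn S x := Relation.ReflTransGen.refl

theorem componentIn_closed (ha : a ∈ G.componentIn S x) (hb : b ∈ S) (hab : G.Adj a b) :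
    b ∈ G.componentIn S x := Relation.ReflTransGen.tail ha ⟨hab, hb⟩

theorem componentIn_subset (hx : x ∈ S) : G.componentIn S x ⊆ S := by
  intro y hy
  rcases Relation.ReflTransGen.cases_tail hy with rfl | ⟨_, -, h⟩
  exacts [hx, h.2]

theorem connSet_componentIn : G.ConnSet (G.componentIn S x) := by
  refine ⟨⟨x, mem_componentIn_self⟩, fun A hA ⟨a, ha⟩ hcl => ?_⟩
  have hxA : x ∈ A := by
    by_contra hxA
    have : ∀ y ∈ G.componentIn S x, y ∉ A := by
      intro y hy
      induction hy with
      | refl => exact hxA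
      | tail hb hbc ih => exact fun hc => ih (hcl _ hc _ hb hbc.1.symm)
    exact this a (hA ha) ha
  intro y hy
  induction hy with
  | refl => exact hxA
  | tail hb hbc ih => exact hcl _ ih _ (componentIn_closed hb hbc.2 hbc.1) hbc.1

/-- A connected set that meets a set closed under adjacency inside it is contained in that set. -/
theorem ConnSet.subset_of_closed {W K : Set V} (hW : G.ConnSet W) (hy : y ∈ W) (hyK : y ∈ K)
    (hcl : ∀ a ∈ K, a ∈ W → ∀ b ∈ W, G.Adj a b → b ∈ K) : W ⊆ K :=
  (hW.2 (W ∩ K) Set.inter_subset_left ⟨y, hy, hyK⟩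
    (fun a ha b hb hab => ⟨hb, hcl a ha.2 ha.1 b hb hab⟩)).trans Set.inter_subset_right

theorem ConnSet.subset_componentIn {W : Set V} (hW : G.ConnSet W) (hWS : W ⊆ S) (hy : y ∈ W)
    (hyx : y ∈ G.componentIn S x) : W ⊆ G.componentIn S x :=
  hW.subset_of_closed hy hyx fun _ ha _ _ hb hab => componentIn_closed ha (hWS hb) hab

theorem componentIn_eq (hx : x ∈ S) (h : y ∈ G.componentIn S x) :
    G.componentIn S y = G.componentIn S x := by
  have h1 := connSet_componentIn.subset_componentIn (componentIn_subset (componentIn_subset hx h))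
    mem_componentIn_self h
  have h2 := connSet_componentIn.subset_componentIn (componentIn_subset hx) h
    (mem_componentIn_self (G := G) (S := S))
  exact h1.antisymm h2

/-- In a connected set `S`, each component of the rest of `S` after deleting `x` has a neighbor
at `x`. -/
theorem ConnSet.touches_componentIn (hS : G.ConnSet S) (hx : x ∈ S) (hy : y ∈ S) (hyx : y ≠ x) :
    G.Touches (G.componentIn (S \ {x}) y) {x} := by
  have hsub := componentIn_subset (G := G) (S := S \ {x}) (x := y) ⟨hy, hyx⟩
  obtain ⟨a, ha, b, hb, hbA, hab⟩ := hS.exists_adj (hsub.trans Set.sdiff_subset)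
    ⟨y, mem_componentIn_self⟩ hx (fun h => (hsub h).2 rfl)
  refine touches_singleton.2 ⟨a, ha, ?_⟩
  by_cases hbx : b = x
  · exact hbx ▸ hab
  · exact absurd (componentIn_closed ha ⟨hb, hbx⟩ hab) hbA

/-- What remains of a connected set after removing one of the components that appear on deleting the
vertex `x` is connected. -/
theorem ConnSet.diff_componentIn (hS : G.ConnSet S) (hx : x ∈ S) (hy : y ∈ S) (hyx : y ≠ x) :
    G.ConnSet (S \ G.componentIn (S \ {x}) y) := by
  have hsub := componentIn_subset (G := G) (S := S \ {x}) (x := y) ⟨hy, hyx⟩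
  have hxY : x ∉ G.componentIn (S \ {x}) y := fun h => (hsub h).2 rfl
  refine ⟨⟨x, hx, hxY⟩, fun A hA hne hcl => ?_⟩
  have hxA : x ∈ A := by
    by_contra hxA
    refine hxA (hS.2 A (hA.trans Set.sdiff_subset) hne (fun a ha b hb hab => ?_) hx)
    refine hcl a ha b ⟨hb, fun hbY => (hA ha).2 ?_⟩ hab
    exact componentIn_closed hbY ⟨(hA ha).1, fun h => hxA (h ▸ ha)⟩ hab.symm
  have hall : S ⊆ A ∪ G.componentIn (S \ {x}) y := by
    refine hS.2 _ (Set.union_subset (hA.trans Set.sdiff_subset) (hsub.trans Set.sdiff_subset))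
      ⟨x, Or.inl hxA⟩ ?_
    rintro a (ha | ha) b hb hab
    · by_cases hbY : b ∈ G.componentIn (S \ {x}) y
      · exact Or.inr hbY
      · exact Or.inl (hcl a ha b ⟨hb, hbY⟩ hab)
    · by_cases hbx : b = x
      · exact Or.inl (hbx ▸ hxA)
      · exact Or.inr (componentIn_closed ha ⟨hb, hbx⟩ hab)
  exact fun z hz => (hall hz.1).resolve_right hz.2

end componentIn

theorem K4MinorFree.elim (h : G.K4MinorFree) {A B C D : Set V} (hA : G.ConnSet A)
    (hB : G.ConnSet B) (hC : G.ConnSet C) (hD : G.ConnSet D) (dAB : Disjoint A B)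
    (dAC : Disjoint A C) (dAD : Disjoint A D) (dBC : Disjoint B C) (dBD : Disjoint B D)
    (dCD : Disjoint C D) (tAB : G.Touches A B) (tAC : G.Touches A C) (tAD : G.Touches A D)
    (tBC : G.Touches B C) (tBD : G.Touches B D) (tCD : G.Touches C D) : False := by
  refine h ![A, B, C, D] ?_ ?_ ?_ <;> simp [Fin.forall_fin_succ, *]

theorem K23MinorFree.elim (h : G.K23MinorFree) {A A' B B' B'' : Set V} (hA : G.ConnSet A)
    (hA' : G.ConnSet A') (hB : G.ConnSet B) (hB' : G.ConnSet B') (hB'' : G.ConnSet B'')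
    (dA : Disjoint A A') (dB : Disjoint B B') (dB' : Disjoint B B'') (dB'' : Disjoint B' B'')
    (d1 : Disjoint A B) (d2 : Disjoint A B') (d3 : Disjoint A B'') (d4 : Disjoint A' B)
    (d5 : Disjoint A' B') (d6 : Disjoint A' B'') (t1 : G.Touches A B) (t2 : G.Touches A B')
    (t3 : G.Touches A B'') (t4 : G.Touches A' B) (t5 : G.Touches A' B')
    (t6 : G.Touches A' B'') : False := by
  refine h ![A, A'] ![B, B', B''] ?_ ?_ ?_ ?_ ?_ ?_ <;>
    simp [Fin.forall_fin_succ, dA.symm, dB.symm, dB'.symm, dB''.symm, *]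

/-! ### A light vertex -/

/-- `u` has at most two neighbors, and if it has two, one of them has degree at most four. -/
def IsLight (G : SimpleGraph V) (u : V) : Prop :=
  ∃ v x, (∀ w, G.Adj u w → w = v ∨ w = x) ∧ (v = x ∨ (G.neighborSet v).ncard ≤ 4)

/-- All neighbors of vertices of `C` outside of `C` are in `P`. -/
def BoundedBy (G : SimpleGraph V) (C P : Set V) : Prop :=
  ∀ u ∈ C, ∀ v, G.Adj u v → v ∉ C → v ∈ P

theorem BoundedBy.componentIn {C P : Set V} (h : G.BoundedBy C P) {x y : V} (hy : y ∈ C)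
    (hyx : y ≠ x) : G.BoundedBy (G.componentIn (C \ {x}) y) (insert x P) := by
  intro u hu v huv hv
  by_cases hvx : v = x
  · exact Or.inl hvx
  · by_cases hvC : v ∈ C
    · exact absurd (componentIn_closed hu ⟨hvC, hvx⟩ huv) hv
    · exact Or.inr (h u (componentIn_subset (S := C \ {x}) ⟨hy, hyx⟩ hu).1 v huv hvC)

theorem BoundedBy.diff {C P : Set V} (h : G.BoundedBy C P) {q : V} (hq : ¬ G.Touches C {q}) :
    G.BoundedBy C (P \ {q}) := fun u hu v huv hv =>
  ⟨h u hu v huv hv, fun hvq => hq ⟨u, hu, v, hvq, huv⟩⟩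

/-- `C` has a light vertex whenever at most one vertex outside of `C` has neighbors in `C`. -/
def LightAtCut (G : SimpleGraph V) (C : Set V) : Prop :=
  ∀ p ∉ C, G.BoundedBy C {p} → ∃ u ∈ C, G.IsLight u

/-- `C` has a light vertex or is a single vertex whenever at most two vertices outside of `C` have
neighbors in `C` and these two are connected outside of `C`. -/
def LightAtTwoCut (G : SimpleGraph V) (C : Set V) : Prop :=
  ∀ p q W, p ≠ q → G.BoundedBy C {p, q} → G.ConnSet W → p ∈ W → q ∈ W → Disjoint W C →
    (∃ u ∈ C, G.IsLight u) ∨ ∃ c, C = {c}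

/-- At most two vertices can be adjacent both to a vertex and to a connected set. -/
theorem K23MinorFree.ncard_le_two (h : G.K23MinorFree) {x : V} {W T : Set V} (hxW : x ∉ W)
    (hW : G.ConnSet W) (hT : ∀ s ∈ T, s ≠ x ∧ s ∉ W ∧ G.Adj x s ∧ G.Touches W {s}) :
    T.ncard ≤ 2 := by
  by_contra! hlt
  obtain ⟨a, b, c, ha, hb, hc, hab, hac, hbc⟩ := (Set.two_lt_ncard_iff
    (Set.finite_of_ncard_pos (by omega))).1 hlt
  obtain ⟨a1, a2, a3, a4⟩ := hT a ha
  obtain ⟨b1, b2, b3, b4⟩ := hT b hb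
  obtain ⟨c1, c2, c3, c4⟩ := hT c hc
  exact h.elim (connSet_singleton x) hW (connSet_singleton a) (connSet_singleton b)
    (connSet_singleton c) (by simpa) (by simpa) (by simpa) (by simpa) (by simpa using a1.symm)
    (by simpa using b1.symm) (by simpa using c1.symm) (by simpa) (by simpa) (by simpa)
    (touches_singleton_singleton.2 a3) (touches_singleton_singleton.2 b3)
    (touches_singleton_singleton.2 c3) a4 b4 c4

/-- If all components of `C` minus `x` are single vertices and none of them is adjacent to both `p`
and `q`, then `C` has a light vertex, as there are at most two of them and `x` has degree at most
four. Here `p = q` is allowed. -/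
theorem exists_isLight_of_star [Finite V] (h : G.K23MinorFree) {C W : Set V} {x p q : V}
    (hC : G.ConnSet C) (hx : x ∈ C) (hCx : ∃ s ∈ C, s ≠ x) (hCpq : G.BoundedBy C {p, q})
    (hW : G.ConnSet W) (hp : p ∈ W)
    (hq : q ∈ W) (hWC : Disjoint W C) (hsingle : ∀ s ∈ C, s ≠ x → G.componentIn (C \ {x}) s = {s})
    (hpq : ∀ s ∈ C, s ≠ x → G.Adj s p → G.Adj s q → p = q) : ∃ u ∈ C, G.IsLight u := by
  by_contra! hno
  have hxs : ∀ s ∈ C, s ≠ x → G.Adj x s := fun s hs hsx => by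
    have := hC.touches_componentIn hx hs hsx
    rw [hsingle s hs hsx, touches_singleton_singleton] at this
    exact this.symm
  have hnb : ∀ s ∈ C, s ≠ x → ∀ w, G.Adj s w → w = x ∨ w = p ∨ w = q := fun s hs hsx w hsw => by
    have := hCpq.componentIn hs hsx
    rw [hsingle s hs hsx] at this
    simpa using this s rfl w hsw (by simpa using hsw.ne')
  have hdeg : (G.neighborSet x).ncard ≤ 4 := by
    have h2 : (C \ {x}).ncard ≤ 2 := by
      refine h.ncard_le_two (x := x) (W := W) (Set.disjoint_right.1 hWC hx) hW fun s hs => ?_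
      refine ⟨hs.2, Set.disjoint_right.1 hWC hs.1, hxs s hs.1 hs.2, touches_singleton.2 ?_⟩
      by_contra! hW'
      refine hno s hs.1 ⟨x, x, fun w hw => ?_, Or.inl rfl⟩
      rcases hnb s hs.1 hs.2 w hw with rfl | rfl | rfl
      · simp
      · exact absurd hw.symm (hW' _ hp)
      · exact absurd hw.symm (hW' _ hq)
    have hsub : G.neighborSet x ⊆ (C \ {x}) ∪ {p, q} := fun w hw => by
      by_cases hwC : w ∈ C
      · exact Or.inl ⟨hwC, (G.ne_of_adj hw).symm⟩
      · exact Or.inr (hCpq x hx w hw hwC)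
    have h3 := Set.ncard_le_ncard hsub (Set.toFinite _)
    have h4 := Set.ncard_union_le (C \ {x}) {p, q}
    have h5 := (Set.ncard_insert_le p {q}).trans_eq (by rw [Set.ncard_singleton])
    omega
  obtain ⟨s, hs, hsx⟩ := hCx
  by_cases hsp : G.Adj s p
  · refine hno s hs ⟨x, p, fun w hw => ?_, Or.inr hdeg⟩
    rcases hnb s hs hsx w hw with rfl | rfl | rfl
    · simp
    · simp
    · exact Or.inr (hpq s hs hsx hsp hw).symm
  · refine hno s hs ⟨x, q, fun w hw => ?_, Or.inr hdeg⟩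
    rcases hnb s hs hsx w hw with rfl | rfl | rfl
    · simp
    · exact absurd hw hsp
    · simp

/-- Let `p` and `q` be connected outside of the connected set `C`. Of two neighbors `x` and `y` of `p`
in `C`, at least one cannot reach the neighbors of `q` inside `C` without passing through the other.
Otherwise let `Y` be the component of `y` after deleting `x`, and let `X` be the rest of `C`.
If `X` touches `q`, then `p`, `X`, `Y` and `q` give a `K₄` minor; if not, then `X` is joined to `q`
through a part `Z` of `Y` that does not contain `y`, and `p` and `Z` are the smaller side of a `K₂,₃`
minor with `X`, `y` and `q` on the other side. -/
theorem not_touches_of_adj (h4 : G.K4MinorFree) (h23 : G.K23MinorFree) {C W : Set V} {p q x y : V}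
    (hC : G.ConnSet C) (hpq : p ≠ q) (hW : G.ConnSet W) (hp : p ∈ W) (hq : q ∈ W)
    (hWC : Disjoint W C) (hx : x ∈ C) (hy : y ∈ C) (hyx : y ≠ x) (hxp : G.Adj x p)
    (hyp : G.Adj y p) (hyq : G.Touches (G.componentIn (C \ {x}) y) {q}) :
    ¬ G.Touches (G.componentIn (C \ {y}) x) {q} := by
  intro hxq
  set Q := G.componentIn (W \ {p}) q
  have hQsub : Q ⊆ W \ {p} := componentIn_subset ⟨hq, hpq.symm⟩
  have hQ : G.ConnSet Q := connSet_componentIn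
  have hqQ : {q} ⊆ Q := Set.singleton_subset_iff.2 mem_componentIn_self
  have hQp : G.Touches Q {p} := hW.touches_componentIn hp hq hpq.symm
  have hQC : Disjoint Q C := hWC.mono_left (hQsub.trans Set.sdiff_subset)
  have hpC : p ∉ C := Set.disjoint_left.1 hWC hp
  have hpQ : p ∉ Q := fun h => (hQsub h).2 rfl
  set Y := G.componentIn (C \ {x}) y
  have hYsub : Y ⊆ C \ {x} := componentIn_subset ⟨hy, hyx⟩
  have hY : G.ConnSet Y := connSet_componentIn
  have hyY : y ∈ Y := mem_componentIn_self
  have hX : G.ConnSet (C \ Y) := hC.diff_componentIn hx hy hyx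
  have hxX : x ∈ C \ Y := ⟨hx, fun h => (hYsub h).2 rfl⟩
  have hYX : G.Touches Y (C \ Y) := (hC.touches_componentIn hx hy hyx).mono subset_rfl (by simpa)
  have hpX : Disjoint {p} (C \ Y) := by simp [hpC]
  have hpx : G.Touches {p} (C \ Y) := ⟨p, rfl, x, hxX, hxp.symm⟩
  by_cases hXq : G.Touches (C \ Y) {q}
  · exact h4.elim (connSet_singleton p) hX hY hQ hpX
      (by simpa using fun h => hpC (hYsub h).1) (by simpa)
      Set.disjoint_sdiff_left (hQC.symm.mono_left Set.sdiff_subset)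
      (hQC.symm.mono_left (hYsub.trans Set.sdiff_subset)) hpx ⟨p, rfl, y, hyY, hyp.symm⟩ hQp.symm
      hYX.symm (hXq.mono subset_rfl hqQ) (hyq.mono subset_rfl hqQ)
  · set X' := G.componentIn (C \ {y}) x
    have hX'sub : X' ⊆ C \ {y} := componentIn_subset ⟨hx, hyx.symm⟩
    obtain ⟨z, hz, hzq⟩ := touches_singleton.1 hxq
    have hzY : z ∈ Y := by
      by_contra h
      exact hXq (touches_singleton.2 ⟨z, ⟨(hX'sub hz).1, h⟩, hzq⟩)
    set Z := G.componentIn (Y \ {y}) z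
    have hZsub : Z ⊆ Y \ {y} := componentIn_subset ⟨hzY, (hX'sub hz).2⟩
    have hZ : G.ConnSet Z := connSet_componentIn
    have hzZ : z ∈ Z := mem_componentIn_self
    have hZC : Z ⊆ C := hZsub.trans (Set.sdiff_subset.trans (hYsub.trans Set.sdiff_subset))
    have hZX : G.Touches Z (C \ Y) := by
      by_contra hZX
      have hsub : X' ⊆ Z := by
        refine connSet_componentIn.subset_of_closed hz hzZ fun a ha _ b hb hab => ?_
        have hb' := hX'sub hb
        by_cases hbY : b ∈ Y
        · exact componentIn_closed ha ⟨hbY, hb'.2⟩ hab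
        · exact absurd ⟨a, ha, b, ⟨hb'.1, hbY⟩, hab⟩ hZX
      exact hxX.2 (hZsub (hsub mem_componentIn_self)).1
    exact h23.elim (connSet_singleton p) hZ hX (connSet_singleton y) hQ
      (by simpa using fun h => hpC (hZC h))
      (by simpa using fun _ => hyY) (hQC.symm.mono_left Set.sdiff_subset)
      (by simpa using Set.disjoint_right.1 hQC hy)
      hpX (by simpa using hyp.ne') (by simpa)
      (Set.disjoint_left.2 fun a ha h => h.2 (hZsub ha).1)
      (by simpa using fun h => (hZsub h).2 rfl) (hQC.symm.mono_left hZC)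
      hpx (touches_singleton_singleton.2 hyp.symm) hQp.symm hZX
      (hY.touches_componentIn hyY hzY (hX'sub hz).2) ⟨z, hzZ, q, hqQ rfl, hzq⟩

section induction

variable [Finite V] {C : Set V}

/-- Inside a set `C` as in `LightAtTwoCut`, a component of `C` minus `x` that does not touch `q` is a
single vertex. Indeed its boundary is contained in `{x, p}`. If `x` and `p` are connected outside of
it, then it is covered by induction; otherwise, together with all that is connected with `x` outside
of it, it is a smaller set with boundary `p`. -/
theorem componentIn_eq_singleton
    (ih : ∀ D : Set V, D.ncard < C.ncard → G.ConnSet D → G.LightAtCut D ∧ G.LightAtTwoCut D)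
    (hno : ∀ u ∈ C, ¬ G.IsLight u) {W : Set V} {p q x y : V}
    (hC : G.ConnSet C) (hCpq : G.BoundedBy C {p, q}) (hW : G.ConnSet W) (hp : p ∈ W) (hq : q ∈ W)
    (hWC : Disjoint W C) (hCq : G.Touches C {q}) (hx : x ∈ C) (hy : y ∈ C) (hyx : y ≠ x)
    (hyq : ¬ G.Touches (G.componentIn (C \ {x}) y) {q}) : G.componentIn (C \ {x}) y = {y} := by
  set D := G.componentIn (C \ {x}) y
  have hDsub : D ⊆ C \ {x} := componentIn_subset ⟨hy, hyx⟩
  have hDC : D ⊆ C := hDsub.trans Set.sdiff_subset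
  have hD : G.ConnSet D := connSet_componentIn
  have hDx : G.Touches D {x} := hC.touches_componentIn hx hy hyx
  have hxD : x ∉ D := fun h => (hDsub h).2 rfl
  have hpC : p ∉ C := Set.disjoint_left.1 hWC hp
  have hDb : G.BoundedBy D {x, p} := by
    intro u hu v huv hv
    obtain ⟨h1, h2⟩ := (hCpq.componentIn hy hyx).diff hyq u hu v huv hv
    rcases h1 with h | h | h
    exacts [Or.inl h, Or.inr h, absurd h h2]
  have hDcard : D.ncard < C.ncard :=
    Set.ncard_lt_ncard ⟨hDC, fun h => hxD (h hx)⟩ (Set.toFinite _)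
  set K := G.componentIn Dᶜ x
  have hKsub : K ⊆ Dᶜ := componentIn_subset hxD
  have hK : G.ConnSet K := connSet_componentIn
  have hxK : x ∈ K := mem_componentIn_self
  by_cases hpK : p ∈ K
  · rcases (ih D hDcard hD).2 x p K (fun h => hpC (h ▸ hx)) hDb hK hxK hpK
      (Set.disjoint_left.2 hKsub) with ⟨u, hu, hul⟩ | ⟨c, hc⟩
    · exact absurd hul (hno u (hDC hu))
    · have : y ∈ D := mem_componentIn_self
      rw [hc] at this ⊢
      rw [Set.mem_singleton_iff.1 this]
  · have hWD : W ⊆ Dᶜ := Set.disjoint_left.1 (hWC.mono_right hDC)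
    have hqK : q ∉ K := fun h => hpK (hW.subset_componentIn hWD hq h hp)
    have hKC : K ⊆ C := by
      refine hK.subset_of_closed hxK hx fun a ha _ b hb hab => ?_
      by_contra hbC
      rcases hCpq a ha b hab hbC with rfl | rfl
      exacts [hpK hb, hqK hb]
    have hKD : G.BoundedBy (K ∪ D) {p} := by
      rintro u (hu | hu) v huv hv
      · exact absurd (componentIn_closed hu (fun h => hv (Or.inr h)) huv) fun h => hv (Or.inl h)
      · rcases hDb u hu v huv fun h => hv (Or.inr h) with rfl | h
        · exact absurd (Or.inl hxK) hv
        · exact h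
    have hKDC : K ∪ D ⊆ C := Set.union_subset hKC hDC
    obtain ⟨c, hc, hcq⟩ := touches_singleton.1 hCq
    have hcard : (K ∪ D).ncard < C.ncard := by
      refine Set.ncard_lt_ncard ⟨hKDC, fun h => ?_⟩ (Set.toFinite _)
      rcases h hc with h | h
      · exact hqK (componentIn_closed h (hWD hq) hcq)
      · exact hyq (touches_singleton.2 ⟨c, h, hcq⟩)
    obtain ⟨u, hu, hul⟩ := (ih _ hcard (hK.union hD (hDx.symm.mono (by simpa) subset_rfl))).1 p
      (fun h => hpC (hKDC h)) hKD
    exact absurd hul (hno u (hKDC hu))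

/-- Delete from `C` a neighbor `q` of `p`, the only vertex outside of `C` that may have neighbors in
`C`. The components that remain have their boundary in the adjacent pair `{p, q}`. If `p` has no
neighbor in `C`, any vertex `q` of `C` serves. -/
theorem lightAtCut_of_smaller (h23 : G.K23MinorFree) (hC : G.ConnSet C)
    (ih : ∀ D : Set V, D.ncard < C.ncard → G.ConnSet D → G.LightAtCut D ∧ G.LightAtTwoCut D) :
    G.LightAtCut C := by
  intro p hpC hCp
  by_contra! hno
  -- `q` is a neighbor of `p` if there is one
  obtain ⟨q, hq, hqp⟩ : ∃ q ∈ C, ¬ G.Adj q p → ¬ G.Touches C {p} := by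
    by_cases h : G.Touches C {p}
    · obtain ⟨q, hq, hqp⟩ := touches_singleton.1 h
      exact ⟨q, hq, fun h => absurd hqp h⟩
    · obtain ⟨q, hq⟩ := hC.1
      exact ⟨q, hq, fun _ => h⟩
  by_cases hCq : ∃ s ∈ C, s ≠ q
  swap
  · push Not at hCq
    refine hno q hq ⟨p, p, fun w hw => Or.inl (hCp q hq w hw fun hwC => ?_), Or.inl rfl⟩
    exact (G.ne_of_adj hw).symm (hCq w hwC)
  have hsmall : ∀ s ∈ C, s ≠ q → G.componentIn (C \ {q}) s ⊆ C \ {q} ∧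
      (G.componentIn (C \ {q}) s).ncard < C.ncard := fun s hs hsq => by
    have hsub := componentIn_subset (G := G) (S := C \ {q}) (x := s) ⟨hs, hsq⟩
    exact ⟨hsub, Set.ncard_lt_ncard ⟨hsub.trans Set.sdiff_subset, fun h => (hsub (h hq)).2 rfl⟩
      (Set.toFinite _)⟩
  have hqC : ∀ s ∈ C, s ≠ q → q ∉ G.componentIn (C \ {q}) s := fun s hs hsq h =>
    ((hsmall s hs hsq).1 h).2 rfl
  by_cases hadj : G.Adj q p
  · have hsingle : ∀ s ∈ C, s ≠ q → G.componentIn (C \ {q}) s = {s} := fun s hs hsq => by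
      obtain ⟨hsub, hcard⟩ := hsmall s hs hsq
      rcases (ih _ hcard connSet_componentIn).2 q p {q, p} hadj.ne (hCp.componentIn hs hsq)
        (connSet_pair hadj) (by simp) (by simp)
        (by simpa using ⟨hqC s hs hsq, fun h => hpC (hsub h).1⟩) with ⟨u, hu, hul⟩ | ⟨c, hc⟩
      · exact absurd hul (hno u (hsub hu).1)
      · have : s ∈ G.componentIn (C \ {q}) s := mem_componentIn_self
        rw [hc] at this ⊢
        rw [Set.mem_singleton_iff.1 this]
    obtain ⟨u, hu, hul⟩ := exists_isLight_of_star h23 hC hq hCq (p := p) (q := p) (by simpa)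
      (connSet_singleton p) rfl rfl (by simpa) hsingle fun _ _ _ _ _ => rfl
    exact hno u hu hul
  · obtain ⟨s, hs, hsq⟩ := hCq
    obtain ⟨hsub, hcard⟩ := hsmall s hs hsq
    have hb : G.BoundedBy (G.componentIn (C \ {q}) s) {q} := by
      intro u hu v huv hv
      rcases hCp.componentIn hs hsq u hu v huv hv with h | rfl
      · exact h
      · exact absurd (touches_singleton.2 ⟨u, (hsub hu).1, huv⟩) (hqp hadj)
    obtain ⟨u, hu, hul⟩ := (ih _ hcard connSet_componentIn).1 q (hqC s hs hsq) hb
    exact hno u (hsub hu).1 hul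

theorem lightAtTwoCut_of_smaller (h4 : G.K4MinorFree) (h23 : G.K23MinorFree) (hC : G.ConnSet C)
    (hcut : G.LightAtCut C)
    (ih : ∀ D : Set V, D.ncard < C.ncard → G.ConnSet D → G.LightAtCut D ∧ G.LightAtTwoCut D) :
    G.LightAtTwoCut C := by
  intro p q W hpq hCpq hW hp hq hWC
  by_contra! hcon
  obtain ⟨hno, hsing⟩ := hcon
  have hpC : p ∉ C := Set.disjoint_left.1 hWC hp
  have hqC : q ∉ C := Set.disjoint_left.1 hWC hq
  have hCq : G.Touches C {q} := by
    by_contra h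
    obtain ⟨u, hu, hul⟩ := hcut p hpC fun u hu v huv hv => by
      obtain ⟨h1 | h1, h2⟩ := hCpq.diff h u hu v huv hv
      exacts [h1, absurd h1 h2]
    exact hno u hu hul
  have hCp : G.Touches C {p} := by
    by_contra h
    obtain ⟨u, hu, hul⟩ := hcut q hqC fun u hu v huv hv => by
      obtain ⟨h1 | h1, h2⟩ := hCpq.diff h u hu v huv hv
      exacts [absurd h1 h2, h1]
    exact hno u hu hul
  have hother : ∀ x ∈ C, ∃ s ∈ C, s ≠ x := fun x hx => by
    by_contra! h
    exact hsing x (Set.Subset.antisymm h (by simpa))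
  have hq' : ∀ x ∈ C, ∀ y ∈ C, y ≠ x → ¬ G.Touches (G.componentIn (C \ {x}) y) {q} →
      G.componentIn (C \ {x}) y = {y} := fun x hx y hy hyx =>
    componentIn_eq_singleton ih hno hC hCpq hW hp hq hWC hCq hx hy hyx
  have hp' : ∀ x ∈ C, ∀ y ∈ C, y ≠ x → ¬ G.Touches (G.componentIn (C \ {x}) y) {p} →
      G.componentIn (C \ {x}) y = {y} := fun x hx y hy hyx =>
    componentIn_eq_singleton ih hno hC (Set.pair_comm p q ▸ hCpq) hW hq hp hWC hCp hx hy hyx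
  -- some component touches both `p` and `q`, as otherwise all of them are single vertices
  have hfull : ∀ x ∈ C, ∃ y ∈ C, y ≠ x ∧ G.Adj y p ∧
      G.Touches (G.componentIn (C \ {x}) y) {q} := by
    intro x hx
    by_contra! hnot
    have hnf : ∀ s ∈ C, s ≠ x → G.Touches (G.componentIn (C \ {x}) s) {p} →
        ¬ G.Touches (G.componentIn (C \ {x}) s) {q} := by
      intro s hs hsx htp
      obtain ⟨y, hy, hyp⟩ := touches_singleton.1 htp
      have hsm : s ∈ C \ {x} := ⟨hs, hsx⟩
      have hy' := componentIn_subset hsm hy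
      rw [← componentIn_eq hsm hy]
      exact hnot y hy'.1 hy'.2 hyp
    have hsingle : ∀ s ∈ C, s ≠ x → G.componentIn (C \ {x}) s = {s} := fun s hs hsx => by
      by_cases htp : G.Touches (G.componentIn (C \ {x}) s) {p}
      · exact hq' x hx s hs hsx (hnf s hs hsx htp)
      · exact hp' x hx s hs hsx htp
    obtain ⟨u, hu, hul⟩ := exists_isLight_of_star h23 hC hx (hother x hx) hCpq hW hp hq hWC hsingle
      fun s hs hsx hsp hsq => by
        have := hnf s hs hsx
        rw [hsingle s hs hsx, touches_singleton_singleton, touches_singleton_singleton] at this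
        exact absurd hsq (this hsp)
    exact hno u hu hul
  have hback : ∀ x ∈ C, ∀ y ∈ C, y ≠ x → G.Adj x p → G.Adj y p →
      G.Touches (G.componentIn (C \ {x}) y) {q} → ¬ G.Touches (G.componentIn (C \ {y}) x) {q} :=
    fun x hx y hy hyx hxp hyp => not_touches_of_adj h4 h23 hC hpq hW hp hq hWC hx hy hyx hxp hyp
  -- three neighbors `x`, `y`, `z` of `p`, each reaching `q` after deletion of the one before
  obtain ⟨x, hx, hxp⟩ := touches_singleton.1 hCp
  obtain ⟨y, hy, hyx, hyp, hyq⟩ := hfull x hx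
  obtain ⟨z, hz, hzy, hzp, hzq⟩ := hfull y hy
  have hxq := hback x hx y hy hyx hxp hyp hyq
  have hyq' := hback y hy z hz hzy hyp hzp hzq
  have hx1 := hq' y hy x hx hyx.symm hxq
  have hy1 := hq' z hz y hy hzy.symm hyq'
  have hxy : G.Adj x y := by
    have := hC.touches_componentIn hy hx hyx.symm
    rwa [hx1, touches_singleton_singleton] at this
  have hxz : x = z := by
    by_contra hxz
    have : x ∈ G.componentIn (C \ {z}) y := componentIn_closed mem_componentIn_self ⟨hx, hxz⟩
      hxy.symm
    rw [hy1] at this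
    exact hyx this.symm
  exact hxq (hxz ▸ hzq)

theorem lightAtCut_and_lightAtTwoCut (h4 : G.K4MinorFree) (h23 : G.K23MinorFree)
    (hC : G.ConnSet C) : G.LightAtCut C ∧ G.LightAtTwoCut C := by
  induction hn : C.ncard using Nat.strong_induction_on generalizing C with
  | _ n ih =>
    have ih' : ∀ D : Set V, D.ncard < C.ncard → G.ConnSet D →
        G.LightAtCut D ∧ G.LightAtTwoCut D := fun D hD hDC => ih _ (hn ▸ hD) hDC rfl
    have hcut := lightAtCut_of_smaller h23 hC ih'
    exact ⟨hcut, lightAtTwoCut_of_smaller h4 h23 hC hcut ih'⟩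

end induction

/-- A nonempty set of vertices that is a union of components of a graph without `K₄` and `K₂,₃` minors
has a light vertex. -/
theorem exists_isLight [Finite V] (h4 : G.K4MinorFree) (h23 : G.K23MinorFree) {S : Set V}
    (hne : S.Nonempty) (hS : G.BoundedBy S ∅) : ∃ u ∈ S, G.IsLight u := by
  obtain ⟨p, hp⟩ := hne
  by_cases hSp : ∃ s ∈ S, s ≠ p
  · obtain ⟨s, hs, hsp⟩ := hSp
    have hsub := componentIn_subset (G := G) (S := S \ {p}) (x := s) ⟨hs, hsp⟩
    obtain ⟨u, hu, hul⟩ := (lightAtCut_and_lightAtTwoCut h4 h23 connSet_componentIn).1 p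
      (fun h => (hsub h).2 rfl) (by simpa using hS.componentIn hs hsp)
    exact ⟨u, (hsub hu).1, hul⟩
  · push Not at hSp
    refine ⟨p, hp, p, p, fun w hw => ?_, Or.inl rfl⟩
    by_cases hwS : w ∈ S
    · exact Or.inl (hSp w hwS)
    · exact absurd (hS p hp w hw hwS) (Set.notMem_empty w)

end SimpleGraph

/-! ### Degenerate sets, orderings and greedy colorings -/

namespace SimpleGraph

/-- The set `A` can be built up vertex by vertex such that each new vertex has at most `k` neighbors
among those that are already there. -/
inductive DegenerateOn {X : Type*} (H : SimpleGraph X) (k : ℕ) : Set X → Prop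
  | empty : DegenerateOn H k ∅
  | cons {A : Set X} {v : X} : DegenerateOn H k A → v ∉ A →
      {x | x ∈ A ∧ H.Adj v x}.ncard ≤ k → DegenerateOn H k (insert v A)

namespace DegenerateOn

variable {X : Type*} {H : SimpleGraph X} {k : ℕ}

theorem union_subsingleton {A P : Set X} (hA : H.DegenerateOn k A) (hP : P.Subsingleton)
    (h : ∀ v ∈ P, v ∉ A → {x | x ∈ A ∧ H.Adj v x}.ncard ≤ k) : H.DegenerateOn k (A ∪ P) := by
  rcases hP.eq_empty_or_singleton with rfl | ⟨v, rfl⟩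
  · rwa [Set.union_empty]
  · rw [Set.union_singleton]
    by_cases hv : v ∈ A
    · rwa [Set.insert_eq_of_mem hv]
    · exact hA.cons hv (h v rfl hv)

theorem exists_rank [Finite X] {A : Set X} (hA : H.DegenerateOn k A) :
    ∃ r : X → ℕ, Set.InjOn r A ∧ ∀ v ∈ A, {x | H.Adj v x ∧ x ∈ A ∧ r x < r v}.ncard ≤ k := by
  classical
  induction hA with
  | empty => exact ⟨fun _ => 0, by simp, by simp⟩
  | @cons A v hA hv hcard ih =>
    obtain ⟨r, hr, hrk⟩ := ih
    obtain ⟨M, hM⟩ := (Set.finite_range r).bddAbove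
    replace hM : ∀ x, r x ≤ M := fun x => hM ⟨x, rfl⟩
    have hne : ∀ a ∈ A, a ≠ v := fun a ha h => hv (h ▸ ha)
    have hup : ∀ a ∈ A, Function.update r v (M + 1) a = r a := fun a ha =>
      Function.update_of_ne (hne a ha) _ _
    refine ⟨Function.update r v (M + 1), ?_, ?_⟩
    · rw [Set.injOn_insert hv]
      refine ⟨hr.congr fun a ha => (hup a ha).symm, ?_⟩
      rintro ⟨a, ha, h⟩
      rw [hup a ha, Function.update_self] at h
      have := hM a
      omega
    · rintro w (rfl | hw)
      · refine (Set.ncard_le_ncard ?_ (Set.toFinite _)).trans hcard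
        rintro x ⟨h1, rfl | h2, h3⟩
        · exact absurd h3 (lt_irrefl _)
        · exact ⟨h2, h1⟩
      · refine (Set.ncard_le_ncard ?_ (Set.toFinite _)).trans (hrk w hw)
        rintro x ⟨h1, rfl | h2, h3⟩
        · rw [hup w hw, Function.update_self] at h3
          have := hM w
          omega
        · rw [hup w hw, hup x h2] at h3
          exact ⟨h1, h2, h3⟩

theorem coloringNumber_le [Finite X] (h : H.DegenerateOn k Set.univ) :
    H.coloringNumber ≤ (k : ℕ∞) + 1 := by
  have := Fintype.ofFinite X
  obtain ⟨r, hr, hrk⟩ := h.exists_rank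
  rw [Set.injOn_univ] at hr
  let _ : LinearOrder X := LinearOrder.lift' r hr
  let σ := Fintype.orderIsoFinOfCardEq X (Nat.card_eq_fintype_card (α := X)).symm
  refine iInf₂_le_of_le (k + 1) ⟨σ.symm.toEquiv, fun v => ?_⟩ (by simp)
  refine Nat.lt_succ_of_le ((Set.ncard_le_ncard ?_ (Set.toFinite _)).trans (hrk v trivial))
  rintro x ⟨h1, h2⟩
  exact ⟨h1, trivial, σ.symm.lt_iff_lt.1 h2⟩

/-- Greedy coloring: each edge forbids one color at its later end. -/
theorem exists_groupListColoring {A : Type*} [AddGroup A] {L : X → Finset A} {S : Set X}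
    (h : H.DegenerateOn k S) [Finite X] (hL : ∀ v, k < (L v).card) (o : H.EdgeOrientation)
    (f : H.edgeSet → A) : ∃ c : X → A, (∀ v, c v ∈ L v) ∧
      ∀ e, o.tail e ∈ S → o.head e ∈ S → c (o.tail e) - c (o.head e) ≠ f e := by
  classical
  induction h with
  | empty =>
    choose c hc using fun v => Finset.card_pos.1 ((Nat.zero_le k).trans_lt (hL v))
    exact ⟨c, hc, by simp⟩
  | @cons S v hS hv hcard ih =>
    obtain ⟨c, hc, hcf⟩ := ih
    -- the color that the edge from `v` to `x` forbids at `v`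
    let forb : X → A := fun x => if hx : H.Adj v x then
      (if o.tail ⟨s(v, x), hx⟩ = v then f ⟨s(v, x), hx⟩ + c x else -f ⟨s(v, x), hx⟩ + c x) else 0
    let N : Finset X := (Set.toFinite {x | x ∈ S ∧ H.Adj v x}).toFinset
    have hN : N.card ≤ k := by rwa [← Set.ncard_eq_toFinset_card]
    obtain ⟨a, ha, haN⟩ : ∃ a ∈ L v, a ∉ N.image forb := by
      by_contra! hsub
      have h1 := Finset.card_le_card (show L v ⊆ N.image forb from hsub)
      have h2 := (Finset.card_image_le (s := N) (f := forb))
      have h3 := hL v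
      omega
    have hane : ∀ x ∈ S, H.Adj v x → forb x ≠ a := fun x hxS hx hxa =>
      haN (Finset.mem_image.2 ⟨x, by simpa [N] using ⟨hxS, hx⟩, hxa⟩)
    refine ⟨Function.update c v a, fun w => ?_, fun e ht hh => ?_⟩
    · by_cases hw : w = v
      · subst hw
        rwa [Function.update_self]
      · rw [Function.update_of_ne hw]
        exact hc w
    · have hends := o.ends e
      have hadj : H.Adj (o.tail e) (o.head e) := by
        rw [← mem_edgeSet, hends]
        exact e.2
      by_cases htv : o.tail e = v
      · have hhv : o.head e ≠ v := fun h => hadj.ne (htv.trans h.symm)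
        have hhS : o.head e ∈ S := hh.resolve_left hhv
        have hadj' : H.Adj v (o.head e) := htv ▸ hadj
        have he : (⟨s(v, o.head e), hadj'⟩ : H.edgeSet) = e := Subtype.ext (by rw [← hends, htv])
        have := hane _ hhS hadj'
        simp only [forb, dif_pos hadj', he, if_pos htv] at this
        rw [htv, Function.update_self, Function.update_of_ne hhv]
        exact fun h => this (sub_eq_iff_eq_add.1 h).symm
      · have htS : o.tail e ∈ S := ht.resolve_left htv
        by_cases hhv : o.head e = v
        · have hadj' : H.Adj v (o.tail e) := hhv ▸ hadj.symm
          have he : (⟨s(v, o.tail e), hadj'⟩ : H.edgeSet) = e :=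
            Subtype.ext (Sym2.eq_swap.trans (by rw [← hends, hhv]))
          have := hane _ htS hadj'
          simp only [forb, dif_pos hadj', he, if_neg htv] at this
          rw [hhv, Function.update_self, Function.update_of_ne htv]
          intro h
          rw [← h] at this
          exact this (by simp)
        · rw [Function.update_of_ne htv, Function.update_of_ne hhv]
          exact hcf e htS (hh.resolve_left hhv)

theorem isGroupChoosable {X : Type u} {H : SimpleGraph X} [Finite X]
    (h : H.DegenerateOn k Set.univ) : IsGroupChoosable.{u, w} H (k + 1) := by
  intro A _ _ L hL o f
  obtain ⟨c, hc, hcf⟩ := h.exists_groupListColoring (L := L) (fun v => by rw [hL v]; omega) o f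
  exact ⟨c, hc, fun e => hcf e trivial trivial⟩

theorem groupChoiceNumber_le {X : Type u} {H : SimpleGraph X} [Finite X]
    (h : H.DegenerateOn k Set.univ) : groupChoiceNumber.{u, w} H ≤ (k : ℕ∞) + 1 :=
  iInf₂_le_of_le (k + 1) h.isGroupChoosable (by simp)

end DegenerateOn

section lowerBound

variable {X : Type u} {H : SimpleGraph X}

theorem IsGroupChoosable.isGroupColorable {k : ℕ} (h : IsGroupChoosable.{u, w} H k)
    (A : Type w) [AddGroup A] (hA : (k : ℕ∞) ≤ ENat.card A) : H.IsGroupColorable A := by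
  intro o f
  obtain ⟨s, -, hs⟩ := Set.exists_subset_encard_eq (s := (Set.univ : Set A)) (k := k)
    (by rwa [Set.encard_univ])
  have hfin : s.Finite := Set.finite_of_encard_eq_coe hs
  obtain ⟨c, -, hc⟩ := h A hA (fun _ => hfin.toFinset)
    (fun _ => by rw [hfin.encard_eq_coe_toFinset_card] at hs; exact_mod_cast hs) o f
  exact ⟨c, hc⟩

theorem groupChromaticNumber_le_groupChoiceNumber :
    groupChromaticNumber.{u, w} H ≤ groupChoiceNumber.{u, w} H :=
  le_iInf₂ fun k hk => iInf₂_le_of_le k (fun A _ hA => IsGroupChoosable.isGroupColorable hk A hA)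
    le_rfl

/-- With all edges labelled zero, a group coloring is a proper coloring. -/
theorem IsGroupColorable.nonempty_coloring {A : Type w} [AddGroup A] (h : H.IsGroupColorable A) :
    Nonempty (H.Coloring A) := by
  let o : H.EdgeOrientation := ⟨fun e => (e : Sym2 X).out.1, fun e => (e : Sym2 X).out.2,
    fun e => Quot.out_eq _⟩
  obtain ⟨c, hc⟩ := h o fun _ => 0
  refine ⟨Coloring.mk c fun {a b} hab heq => hc ⟨s(a, b), hab⟩ (sub_eq_zero.2 ?_)⟩
  have hends := o.ends ⟨s(a, b), hab⟩
  rcases Sym2.eq_iff.1 hends with ⟨h1, h2⟩ | ⟨h1, h2⟩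
  · rw [h1, h2, heq]
  · rw [h1, h2, heq]

/-- A clique of size `n + 1` cannot be colored with the elements of the cyclic group of order `n`. -/
theorem le_groupChromaticNumber {n : ℕ} (hn : n ≠ 0) {s : Finset X} (hs : H.IsNClique (n + 1) s) :
    (n : ℕ∞) + 1 ≤ groupChromaticNumber.{u, w} H := by
  refine le_iInf₂ fun k hk => ?_
  by_contra! hlt
  have hkn : k ≤ n := by
    have : k < n + 1 := by exact_mod_cast hlt
    omega
  have : NeZero n := ⟨hn⟩
  obtain ⟨c⟩ := (hk (ULift.{w} (ZMod n)) (by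
    rw [ENat.card_eq_coe_fintype_card, Fintype.card_ulift, ZMod.card]
    exact_mod_cast hkn)).nonempty_coloring
  have h1 := hs.isClique.card_le_of_coloring c
  rw [hs.card_eq, Fintype.card_ulift, ZMod.card] at h1
  omega

end lowerBound

end SimpleGraph

/-! ### Total graphs -/

namespace SimpleGraph

variable {V : Type u} {G : SimpleGraph V}

/-- The vertices and edges of the subgraph induced by `S`, as vertices of the total graph. -/
def totalOn (G : SimpleGraph V) (S : Set V) : Set (V ⊕ G.edgeSet) :=
  {z | Sum.elim (· ∈ S) (fun e => ∀ v ∈ (e : Sym2 V), v ∈ S) z}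

@[simp] theorem inl_mem_totalOn {S : Set V} {v : V} :
    (Sum.inl v : V ⊕ G.edgeSet) ∈ G.totalOn S ↔ v ∈ S := Iff.rfl

@[simp] theorem inr_mem_totalOn {S : Set V} {e : G.edgeSet} :
    (Sum.inr e : V ⊕ G.edgeSet) ∈ G.totalOn S ↔ ∀ v ∈ (e : Sym2 V), v ∈ S := Iff.rfl

/-- The edges that join `a` to a vertex of `B`, as vertices of the total graph. -/
def starOn (G : SimpleGraph V) (a : V) (B : Set V) : Set (V ⊕ G.edgeSet) :=
  {z | ∃ e : G.edgeSet, z = Sum.inr e ∧ ∃ b ∈ B, (e : Sym2 V) = s(a, b)}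

theorem ncard_starOn_le [Finite V] (a : V) (B : Set V) : (G.starOn a B).ncard ≤ B.ncard := by
  classical
  refine (Set.ncard_le_ncard ?_ (Set.toFinite _)).trans (Set.ncard_image_le
    (f := fun b => if h : G.Adj a b then (Sum.inr ⟨s(a, b), h⟩ : V ⊕ G.edgeSet) else Sum.inl a)
    (Set.toFinite B))
  rintro _ ⟨⟨e, he⟩, rfl, b, hb, rfl⟩
  exact ⟨b, hb, dif_pos he⟩

/-- A neighbor of the edge `e = s(a, b)` in `totalOn S`, where `a ∉ S`, is `b` or an edge at `b`. -/
theorem totalOn_adj_inr {S : Set V} {a b : V} {e : G.edgeSet} (he : (e : Sym2 V) = s(a, b))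
    (ha : a ∉ S) :
    {x | x ∈ G.totalOn S ∧ G.totalGraph.Adj (Sum.inr e) x} ⊆
      insert (Sum.inl b) (G.starOn b {w | w ∈ S ∧ G.Adj b w}) := by
  rintro (w | e') ⟨h1, h2⟩
  · have h2' : w ∈ (e : Sym2 V) := h2
    rw [he, Sym2.mem_iff] at h2'
    rcases h2' with rfl | rfl
    · exact absurd h1 ha
    · exact Or.inl rfl
  · obtain ⟨-, v, hv, hv'⟩ := lineGraph_adj_iff_exists.1 (show G.lineGraph.Adj e e' from h2)
    have hvS : v ∈ S := h1 v hv'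
    rw [he, Sym2.mem_iff] at hv
    obtain rfl : v = b := hv.resolve_left fun h => ha (h ▸ hvS)
    obtain ⟨w, hw⟩ := hv'
    refine Or.inr ⟨e', rfl, w, ⟨h1 w (by rw [hw]; simp), ?_⟩, hw⟩
    rw [← mem_edgeSet, ← hw]
    exact e'.2

/-- Let `u` have only the neighbors `v` and `x` in `S`, and append to a suitable
order for `S \ {u}` the edge `s(u, x)`, the edge `s(u, v)` and the vertex `u`. The first edge has at
most as many earlier neighbors as the degree of `x`, the second at most one more than the degree of
`v`, and `u` has at most four. -/
theorem DegenerateOn.totalOn_of_diff [Finite V] {k : ℕ} (hk : 4 ≤ k) {S : Set V} {u v x : V}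
    (hu : u ∈ S) (hdeg : ∀ a, {w | w ∈ S ∧ G.Adj a w}.ncard ≤ k)
    (hux : ∀ w ∈ S, G.Adj u w → w = v ∨ w = x)
    (hv : v = x ∨ (v ∈ S → {w | w ∈ S ∧ G.Adj v w}.ncard + 1 ≤ k))
    (h : G.totalGraph.DegenerateOn k (G.totalOn (S \ {u}))) :
    G.totalGraph.DegenerateOn k (G.totalOn S) := by
  have hedge : ∀ {a : V} {e : G.edgeSet}, (e : Sym2 V) = s(u, a) → G.Adj a u := fun {a e} he => by
    rw [← mem_edgeSet, Sym2.eq_swap, ← he]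
    exact e.2
  -- the neighbor `u` of `a` is not counted in `S \ {u}`
  have hstar : ∀ a, G.Adj a u →
      (G.starOn a {w | w ∈ S \ {u} ∧ G.Adj a w}).ncard + 1 ≤
        {w | w ∈ S ∧ G.Adj a w}.ncard := fun a ha => by
    refine (Nat.succ_le_succ (ncard_starOn_le a _)).trans ?_
    refine Nat.succ_le_of_lt (Set.ncard_lt_ncard ⟨fun w hw => ⟨hw.1.1, hw.2⟩, fun hsub => ?_⟩
      (Set.toFinite _))
    exact (hsub (⟨hu, ha⟩ : u ∈ {w | w ∈ S ∧ G.Adj a w})).1.2 rfl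
  have hsing : ∀ a, (G.starOn u ({a} ∩ S)).Subsingleton := by
    rintro a _ ⟨e, rfl, b, ⟨rfl, -⟩, he⟩ _ ⟨e', rfl, b', ⟨rfl, -⟩, he'⟩
    rw [Subtype.ext (he.trans he'.symm)]
  have huS : u ∉ S \ {u} := fun h => h.2 rfl
  have h1 : G.totalGraph.DegenerateOn k (G.totalOn (S \ {u}) ∪ G.starOn u ({x} ∩ S)) := by
    refine h.union_subsingleton (hsing x) ?_
    rintro _ ⟨e, rfl, b, ⟨rfl, -⟩, he⟩ -
    refine (Set.ncard_le_ncard (totalOn_adj_inr he huS) (Set.toFinite _)).trans ?_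
    refine (Set.ncard_insert_le _ _).trans ((hstar b (hedge he)).trans (hdeg b))
  have h2 : G.totalGraph.DegenerateOn k
      (G.totalOn (S \ {u}) ∪ G.starOn u ({x} ∩ S) ∪ G.starOn u ({v} ∩ S)) := by
    refine h1.union_subsingleton (hsing v) ?_
    rintro _ ⟨e, rfl, b, ⟨rfl, hbS⟩, he⟩ hnew
    have hb := (hv.resolve_left fun h => hnew (Or.inr ⟨e, rfl, b, ⟨h, hbS⟩, he⟩)) hbS
    have hsub : {z | z ∈ G.totalOn (S \ {u}) ∪ G.starOn u ({x} ∩ S) ∧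
        G.totalGraph.Adj (Sum.inr e) z} ⊆
        insert (Sum.inl b) (G.starOn b {w | w ∈ S \ {u} ∧ G.Adj b w}) ∪
          G.starOn u ({x} ∩ S) := by
      rintro z ⟨hz | hz, hadj⟩
      · exact Or.inl (totalOn_adj_inr he huS ⟨hz, hadj⟩)
      · exact Or.inr hz
    refine (Set.ncard_le_ncard hsub (Set.toFinite _)).trans ((Set.ncard_union_le _ _).trans ?_)
    have e1 := Set.ncard_insert_le (Sum.inl b) (G.starOn b {w | w ∈ S \ {u} ∧ G.Adj b w})
    have e2 := hstar b (hedge he)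
    have e3 := Set.ncard_le_one_iff_subsingleton.2 (hsing x)
    omega
  have h3 := h2.union_subsingleton (P := {Sum.inl u}) Set.subsingleton_singleton (by
    rintro _ rfl -
    have hsub : {z | z ∈ G.totalOn (S \ {u}) ∪ G.starOn u ({x} ∩ S) ∪ G.starOn u ({v} ∩ S) ∧
        G.totalGraph.Adj (Sum.inl u) z} ⊆
        {Sum.inl v, Sum.inl x} ∪ G.starOn u ({x} ∩ S) ∪ G.starOn u ({v} ∩ S) := by
      rintro z ⟨(hz | hz) | hz, hadj⟩
      · refine Or.inl (Or.inl ?_)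
        rcases z with w | e
        · rcases hux w hz.1 hadj with rfl | rfl
          · exact Or.inl rfl
          · exact Or.inr rfl
        · exact absurd (hz u hadj) huS
      · exact Or.inl (Or.inr hz)
      · exact Or.inr hz
    refine (Set.ncard_le_ncard hsub (Set.toFinite _)).trans ?_
    have e1 := Set.ncard_union_le ({Sum.inl v, Sum.inl x} ∪ G.starOn u ({x} ∩ S))
      (G.starOn u ({v} ∩ S))
    have e2 := Set.ncard_union_le {Sum.inl v, Sum.inl x} (G.starOn u ({x} ∩ S))
    have e3 := Set.ncard_le_one_iff_subsingleton.2 (hsing x)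
    have e4 := Set.ncard_le_one_iff_subsingleton.2 (hsing v)
    have e5 := Set.ncard_insert_le (Sum.inl v : V ⊕ G.edgeSet) {Sum.inl x}
    rw [Set.ncard_singleton] at e5
    omega)
  convert h3 using 1
  ext (w | e)
  · have : w ∈ S ↔ w = u ∨ (w ∈ S ∧ w ≠ u) := by
      by_cases hwu : w = u <;> simp [hwu, hu]
    simpa [starOn] using this
  · simp only [Set.mem_union, inr_mem_totalOn, Set.mem_singleton_iff, reduceCtorEq, or_false]
    constructor
    · intro he
      by_cases hue : u ∈ (e : Sym2 V)
      · obtain ⟨w, hw⟩ := hue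
        have hwS : w ∈ S := he w (by rw [hw]; simp)
        rcases hux w hwS (hedge hw).symm with rfl | rfl
        · exact Or.inr ⟨e, rfl, w, ⟨rfl, hwS⟩, hw⟩
        · exact Or.inl (Or.inr ⟨e, rfl, w, ⟨rfl, hwS⟩, hw⟩)
      · exact Or.inl (Or.inl fun w hw => ⟨he w hw, fun h => hue (h ▸ hw)⟩)
    · have hst : ∀ {a}, Sum.inr e ∈ G.starOn u ({a} ∩ S) → ∀ w ∈ (e : Sym2 V), w ∈ S := by
        rintro a ⟨e', he', b, ⟨-, hb⟩, heq⟩ w hw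
        rw [Sum.inr.inj he', heq, Sym2.mem_iff] at hw
        rcases hw with rfl | rfl <;> assumption
      rintro ((he | he) | he)
      · exact fun w hw => (he w hw).1
      · exact hst he
      · exact hst he

/-- The spanning subgraph of `G` with the edges inside `S`. -/
def edgesInside (G : SimpleGraph V) (S : Set V) : SimpleGraph V where
  Adj a b := G.Adj a b ∧ a ∈ S ∧ b ∈ S
  symm := ⟨fun _ _ h => ⟨h.1.symm, h.2.2, h.2.1⟩⟩
  loopless := ⟨fun _ h => G.irrefl h.1⟩

theorem edgesInside_le (S : Set V) : G.edgesInside S ≤ G := fun _ _ h => h.1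

theorem K4MinorFree.mono {H : SimpleGraph V} (h : G.K4MinorFree) (hle : H ≤ G) :
    H.K4MinorFree := fun B hB hd ht => h B (fun i => (hB i).mono hle) hd fun i j hij => by
  obtain ⟨a, ha, b, hb, hab⟩ := ht i j hij
  exact ⟨a, ha, b, hb, hle hab⟩

theorem K23MinorFree.mono {H : SimpleGraph V} (h : G.K23MinorFree) (hle : H ≤ G) :
    H.K23MinorFree := fun A B hA hB h1 h2 h3 ht =>
  h A B (fun i => (hA i).mono hle) (fun i => (hB i).mono hle) h1 h2 h3 fun i j => by
    obtain ⟨a, ha, b, hb, hab⟩ := ht i j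
    exact ⟨a, ha, b, hb, hle hab⟩

/-- The total graph of an outerplanar graph is built up by deleting light vertices one by one. For
`k = 4`, the bound four on the degree of a neighbor of a light vertex is too weak, and a bound on all
degrees replaces it. -/
theorem IsOuterplanar.degenerateOn_totalGraph [Finite V] (hG : G.IsOuterplanar) {k : ℕ}
    (hdeg : ∀ v, (G.neighborSet v).ncard ≤ k)
    (hk : 5 ≤ k ∨ k = 4 ∧ ∀ v, (G.neighborSet v).ncard ≤ 3) :
    G.totalGraph.DegenerateOn k Set.univ := by
  have hle : ∀ (S : Set V) (a : V),
      {w | w ∈ S ∧ G.Adj a w}.ncard ≤ (G.neighborSet a).ncard := fun S a =>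
    Set.ncard_le_ncard (fun w hw => hw.2) (Set.toFinite _)
  have key : ∀ S : Set V, G.totalGraph.DegenerateOn k (G.totalOn S) := by
    intro S
    induction hn : S.ncard using Nat.strong_induction_on generalizing S with
    | _ n ih =>
    rcases S.eq_empty_or_nonempty with rfl | hne
    · convert DegenerateOn.empty
      ext (w | ⟨e, he⟩)
      · simp
      · induction e with
        | h a b => exact iff_of_false (fun h => h a (by simp)) id
    · obtain ⟨u, hu, v, x, hux, hv⟩ := exists_isLight
        (hG.k4MinorFree.mono (edgesInside_le S)) (hG.k23MinorFree.mono (edgesInside_le S)) hne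
        (fun a _ b hab hb => absurd hab.2.2 hb)
      refine DegenerateOn.totalOn_of_diff (u := u) (v := v) (x := x) (by omega) hu
        (fun a => (hle S a).trans (hdeg a)) (fun w hw huw => hux w ⟨huw, hu, hw⟩) ?_
        (ih _ (hn ▸ Set.ncard_lt_ncard ⟨Set.sdiff_subset, fun h => (h hu).2 rfl⟩
          (Set.toFinite _)) _ rfl)
      refine hv.imp_right fun hv hvS => ?_
      rcases hk with hk | ⟨rfl, h3⟩
      · have : {w | w ∈ S ∧ G.Adj v w} = (G.edgesInside S).neighborSet v := by
          ext w
          exact ⟨fun h => ⟨h.2, hvS, h.1⟩, fun h => ⟨h.2.2, h.1⟩⟩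
        rw [this]
        omega
      · exact Nat.succ_le_succ ((hle S v).trans (h3 v))
  convert key Set.univ
  ext (w | e) <;> simp

/-- A vertex and the edges at it form a clique of the total graph. -/
theorem exists_isNClique_totalGraph [Fintype V] [DecidableRel G.Adj] (v : V) :
    ∃ s, G.totalGraph.IsNClique (G.degree v + 1) s := by
  classical
  let f : G.neighborSet v → V ⊕ G.edgeSet := fun w => Sum.inr ⟨s(v, w), w.2⟩
  have hf : Function.Injective f := fun a b hab => by
    have := congrArg Subtype.val (Sum.inr.inj hab)
    exact Subtype.ext (Sym2.congr_right.1 this)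
  refine ⟨insert (Sum.inl v) (Finset.univ.image f), ?_, ?_⟩
  · intro a ha b hb hab
    simp only [Finset.coe_insert, Finset.coe_image, Finset.coe_univ, Set.image_univ,
      Set.mem_insert_iff, Set.mem_range] at ha hb
    rcases ha with rfl | ⟨a, rfl⟩ <;> rcases hb with rfl | ⟨b, rfl⟩
    · exact absurd rfl hab
    · exact Sym2.mem_mk_left v (b : V)
    · exact Sym2.mem_mk_left v (a : V)
    · exact lineGraph_adj_iff_exists.2 ⟨fun h => hab (congrArg Sum.inr h), v,
        Sym2.mem_mk_left _ _, Sym2.mem_mk_left _ _⟩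
  · rw [Finset.card_insert_of_notMem (by simp [f]), Finset.card_image_of_injective _ hf,
      Finset.card_univ, card_neighborSet_eq_degree]

end SimpleGraph

theorem mainTheorem6 {V : Type u} [Fintype V] (G : SimpleGraph V) [DecidableRel G.Adj]
    (hG : G.IsOuterplanar) :
    (∀ k : ℕ, 5 ≤ k → G.maxDegree ≤ k → G.totalGraph.coloringNumber ≤ (k : ℕ∞) + 1) ∧
    (G.maxDegree ≠ 4 →
      SimpleGraph.totalGroupChoiceNumber.{u, w} G ≤ max 5 ((G.maxDegree : ℕ∞) + 1)) ∧
    (5 ≤ G.maxDegree →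
      SimpleGraph.totalGroupChoiceNumber.{u, w} G = (G.maxDegree : ℕ∞) + 1 ∧
      SimpleGraph.totalGroupChromaticNumber.{u, w} G = (G.maxDegree : ℕ∞) + 1) := by
  have hdeg : ∀ v, (G.neighborSet v).ncard ≤ G.maxDegree := fun v => by
    rw [← Nat.card_coe_set_eq, Nat.card_eq_fintype_card, SimpleGraph.card_neighborSet_eq_degree]
    exact G.degree_le_maxDegree v
  have hupper : 5 ≤ G.maxDegree →
      SimpleGraph.totalGroupChoiceNumber.{u, w} G ≤ (G.maxDegree : ℕ∞) + 1 := fun h =>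
    (hG.degenerateOn_totalGraph hdeg (Or.inl h)).groupChoiceNumber_le
  refine ⟨fun k hk hk' => ?_, fun h4 => ?_, fun h5 => ?_⟩
  · exact (hG.degenerateOn_totalGraph (fun v => (hdeg v).trans hk')
      (Or.inl hk)).coloringNumber_le
  · rcases lt_or_gt_of_ne h4 with h | h
    · refine le_max_of_le_left ?_
      have h3 : ∀ v, (G.neighborSet v).ncard ≤ 3 := fun v => (hdeg v).trans (by omega)
      refine (hG.degenerateOn_totalGraph (k := 4) (fun v => (h3 v).trans (by omega))
        (Or.inr ⟨rfl, h3⟩)).groupChoiceNumber_le.trans ?_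
      norm_num
    · exact le_max_of_le_right (hupper h)
  · have hne : Nonempty V := by
      by_contra hV
      rw [not_nonempty_iff] at hV
      simp at h5
    obtain ⟨v, hv⟩ := G.exists_maximal_degree_vertex
    obtain ⟨s, hs⟩ := SimpleGraph.exists_isNClique_totalGraph (G := G) v
    rw [← hv] at hs
    have h1 : (G.maxDegree : ℕ∞) + 1 ≤ SimpleGraph.totalGroupChromaticNumber.{u, w} G :=
      SimpleGraph.le_groupChromaticNumber (by omega) hs
    have h2 : SimpleGraph.totalGroupChromaticNumber.{u, w} G ≤
        SimpleGraph.totalGroupChoiceNumber.{u, w} G :=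
      SimpleGraph.groupChromaticNumber_le_groupChoiceNumber
    have h3 := hupper h5
    exact ⟨h3.antisymm (h1.trans h2), (h2.trans h3).antisymm h1⟩
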